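/- **Setting.** A \emph{hard pulse} is a sequence $(\omega_j)_{j\in\mathbb Z}$ of complex numbers with $\sum_j|\omega_j|<\infty$ and $|\omega_j|<\pi$ for all $j$; it has $\rho$ \emph{rephasing time steps} ($\rho\in\mathbb Z$) if $\omega_j=0$ for all $j\ge\rho$. For $w\in S^1$ let $P_w$ be the rotation of $\mathbb R^3$ about the $z$-axis that multiplies $v_x+iv_y$ by $w$, and for $c\in\mathbb C$ let $R_c$ be the right-handed rotation by the angle $|c|$ about the axis $(\operatorname{Re}c,\operatorname{Im}c,0)$ ($R_0$ is the identity). A function $\mathbf M:S^1\to S^2\subset\mathbb R^3$ is the \emph{discrete selective excitation transform} of $\Omega=(\omega_j)$, written $\mathcal T^{\mathrm{disc}}\Omega=\mathbf M$, if for every $w\in S^1$ there is a sequence $M_-(w;j)\in\mathbb R^3$, $j\in\mathbb Z$, with $$M_-(w;j+1)=P_wR_{\omega_j}M_-(w;j),\qquad \lim_{j\to-\infty}M_-(w;j)=(0,0,1)^T,\qquad \lim_{j\to+\infty}P_w^{-j}M_-(w;j)=\mathbf M(w).$$ **Statement.** Let $\mathbf M=(\mathbf M_x,\mathbf M_y,\mathbf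 M_z):S^1\to S^2$ satisfy $\mathbf M_z\neq-1$ everywhere, and suppose that its reflection coefficient $$r=\frac{\mathbf M_x+i\mathbf M_y}{1+\mathbf M_z}$$ is in the Sobolev space $H^1(S^1)$. Let $\rho\in\mathbb Z$ and suppose that $r(w)=w^{-\rho}r_0(w)$ on $S^1$, where $r_0$ extends to a meromorphic function on the open unit disk $\mathbb D$ (again denoted $r_0$) that has the boundary value $r_0(w)$ at every $w\in S^1$ (that is, $r_0(z)\to r_0(w)$ as $z\to w$, $z\in\mathbb D$) and that vanishes at the origin. Then $r_0$ has only finitely many poles $w_1,\dots,w_m$ in $\mathbb D$; let $d_1,\dots,d_m$ be their multiplicities. There exists a hard pulse $\Omega=(\omega_j)$ with $\rho$ rephasing time steps such that $\mathcal T^{\mathrm{disc}}\Omega=\mathbf M$, and every such pulse satisfies $$\sum_{j=-\infty}^{\infty}\log\Bigl(1+\tan^2\frac{|\omega_j|}{2}\Bigr)=\frac1{2\pi}\int_0^{2\pi}\log\bigl(1+|r(e^{i\theta})|^2\bigr)\,d\theta-2\sum_{k=1}^m d_k\log|w_k| .$$ -/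

import Mathlib

open Filter Topology MeasureTheory
open scoped Matrix

noncomputable section

/-- Membership in the Sobolev space `H¹(S¹)`: square integrable, with a square integrable weak
derivative `g` in the angular variable (tested against smooth `2π`-periodic functions). -/
def MemSobolevH1 (f : Circle → ℂ) : Prop :=
  MemLp (fun θ : ℝ => f (Circle.exp θ)) 2 (volume.restrict (Set.Ioc 0 (2 * Real.pi))) ∧
  ∃ g : Circle → ℂ,
    MemLp (fun θ : ℝ => g (Circle.exp θ)) 2 (volume.restrict (Set.Ioc 0 (2 * Real.pi))) ∧
    ∀ φ : ℝ → ℂ, ContDiff ℝ (⊤ : ℕ∞) φ → Function.Periodic φ (2 * Real.pi) →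
      (∫ θ in (0 : ℝ)..(2 * Real.pi), f (Circle.exp θ) * deriv φ θ) +
        (∫ θ in (0 : ℝ)..(2 * Real.pi), g (Circle.exp θ) * φ θ) = 0

/-- Free precession during one time step: rotation about the `z`-axis which multiplies the
transverse component `v_x + i v_y` by `w = exp (i Δ z)`. -/
def precession (w : Circle) (v : Fin 3 → ℝ) : Fin 3 → ℝ :=
  ![((w : ℂ) * (v 0 + Complex.I * v 1)).re, ((w : ℂ) * (v 0 + Complex.I * v 1)).im, v 2]

/-- Effect of one hard pulse `c`: the right-handed rotation by the angle `|c|` about the axis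
`(Re c, Im c, 0)` (Rodrigues' formula; the identity for `c = 0`). -/
def pulseRotation (c : ℂ) (v : Fin 3 → ℝ) : Fin 3 → ℝ :=
  let n : Fin 3 → ℝ := ![c.re / ‖c‖, c.im / ‖c‖, 0]
  Real.cos ‖c‖ • v + Real.sin ‖c‖ • (n ⨯₃ v) + ((1 - Real.cos ‖c‖) * (n ⬝ᵥ v)) • n

/-- `M` is the magnetization profile resulting from the hard pulse `ω`, i.e. `M` is the discrete
selective excitation transform of `ω`: for every `w` the magnetization `m` starts at equilibrium
at `j = -∞`, evolves by the discrete Bloch recursion, and its rephased limit at `+∞` is `M w`. -/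
def IsExcitationTransform (ω : ℤ → ℂ) (M : Circle → Fin 3 → ℝ) : Prop :=
  ∀ w : Circle, ∃ m : ℤ → Fin 3 → ℝ,
    (∀ j, m (j + 1) = precession w (pulseRotation (ω j) (m j))) ∧
    Tendsto m atBot (𝓝 ![0, 0, 1]) ∧
    Tendsto (fun j : ℤ => precession (w ^ (-j)) (m j)) atTop (𝓝 (M w))

/-- The reflection coefficient `(M_x + i M_y) / (1 + M_z)` of a magnetization profile. -/
def reflectionCoeff (M : Circle → Fin 3 → ℝ) (w : Circle) : ℂ :=
  ((M w 0 : ℂ) + Complex.I * (M w 1 : ℂ)) / (1 + (M w 2 : ℂ))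

/-- `F` is a meromorphic extension of `f : S¹ → ℂ` to the open unit disk: `F` is meromorphic in
the disk and has the boundary values `f`. -/
structure IsMeromorphicExtension (f : Circle → ℂ) (F : ℂ → ℂ) : Prop where
  meromorphic : MeromorphicOn F (Metric.ball 0 1)
  boundary : ∀ w : Circle, Tendsto F (𝓝[Metric.ball 0 1] (w : ℂ)) (𝓝 (f w))

/-- The poles of `F` in the open unit disk. -/
def diskPoles (F : ℂ → ℂ) : Set ℂ :=
  {z | z ∈ Metric.ball (0 : ℂ) 1 ∧ meromorphicOrderAt F z < 0}

/-- The multiplicity of a pole. -/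
def poleMultiplicity (F : ℂ → ℂ) (z : ℂ) : ℕ :=
  (-(meromorphicOrderAt F z).untop₀).toNat

/-- `ω` is a hard pulse with `ρ` rephasing time steps which produces the profile `M`. The strengths
are absolutely summable and each flip angle `|ω j|` is less than `π`, so that
`tan (|ω j| / 2)` is a genuine tangent. -/
structure IsRephasedPulse (ρ : ℤ) (M : Circle → Fin 3 → ℝ) (ω : ℤ → ℂ) : Prop where
  summable : Summable fun j => ‖ω j‖
  norm_lt_pi : ∀ j, ‖ω j‖ < Real.pi
  rephasing : ∀ j, ρ ≤ j → ω j = 0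
  transform : IsExcitationTransform ω M

end

/-!
Lift magnetizations to spinors `(A, B)` along the Hopf map, so that `B / A` is the stereographic
coordinate `(M_x + i M_y) / (1 + M_z)`. A hard pulse followed by free precession by `w` then acts as
`(A, B) ↦ (A - conj γ B, w (B + γ A))` with `|γ| = tan (|ω| / 2)`, and for a pulse with `ρ`
rephasing time steps the total spinor is continuous on the closed disk, holomorphic inside, nowhere
zero, equal to `(1, 0)` at `0`, and satisfies `B / A = r₀` on the circle.

For existence, clear the poles of `r₀` by a polynomial and divide by an outer function, so that
`r₀ = B / A` with `A` and `B` coprime in the algebra of holomorphic functions with `H¹` boundary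
values and `|A|² + |B|² = 1` on the circle. A Bézout relation `D A + E B = 1` provides a symbol
`l = (conj B - E) / A` whose negative Fourier coefficients are the kernel of Marchenko equations
solved by `(A, B)`. Stripping off the outermost pulse replaces `(A, B)` by a solution for the
shifted kernel; the tails of this kernel decay fast enough for the parameters `γ` to be summable.

For the energy, each step multiplies `|A|² + |B|²` by `1 + |γ|²` on the circle, so the logarithmic
energy of any pulse producing `M` is the constant value of
`log (|A|² + |B|²) = 2 log |A| + log (1 + |r₀|²)` there. By coprimality `A = Q H`, where `Q` is the
monic polynomial of the poles of `r₀` and `H` has no zeros in the closed disk; since `A(0) = 1`, the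
mean value property of `log |H|` and Jensen's formula for `Q` show that `log |A|` has mean
`-log |Q(0)|`.
-/

open ComplexConjugate

/-! ### Hankel operators on `ℓ¹` and tails of weighted `ℓ²` sequences -/

section Hankel

variable {R : Type*} [NormedRing R] {κ x : ℕ → R}

theorem hankelIndex_injective : Function.Injective fun p : ℕ × ℕ => (p.1 + p.2, p.2) :=
  fun p q h => by
    simp only [Prod.mk.injEq] at h
    exact Prod.ext (by omega) h.2

theorem summable_hankel_prod (hκ : Summable fun n => ‖κ n‖) (hx : Summable fun n => ‖x n‖) :
    Summable fun p : ℕ × ℕ => ‖κ (p.1 + p.2)‖ * ‖x p.2‖ := by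
  have hprod : Summable fun p : ℕ × ℕ => ‖κ p.1‖ * ‖x p.2‖ :=
    hκ.mul_of_nonneg hx (fun _ => norm_nonneg _) fun _ => norm_nonneg _
  exact (hprod.comp_injective hankelIndex_injective :)

theorem summable_norm_hankel_row (hκ : Summable fun n => ‖κ n‖) (hx : Summable fun n => ‖x n‖)
    (m : ℕ) : Summable fun n => ‖κ (m + n) * x n‖ :=
  .of_nonneg_of_le (fun _ => norm_nonneg _) (fun _ => norm_mul_le _ _)
    ((summable_hankel_prod hκ hx).prod_factor m)

theorem norm_hankel_le (hκ : Summable fun n => ‖κ n‖) (hx : Summable fun n => ‖x n‖) (m : ℕ) :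
    ‖∑' n, κ (m + n) * x n‖ ≤ ∑' n, ‖κ (m + n)‖ * ‖x n‖ :=
  tsum_of_norm_bounded ((summable_hankel_prod hκ hx).prod_factor m).hasSum
    fun _ => norm_mul_le _ _

theorem summable_norm_hankel (hκ : Summable fun n => ‖κ n‖) (hx : Summable fun n => ‖x n‖) :
    Summable fun m => ‖∑' n, κ (m + n) * x n‖ :=
  .of_nonneg_of_le (fun _ => norm_nonneg _) (norm_hankel_le hκ hx) (summable_hankel_prod hκ hx).prod

theorem tsum_norm_hankel_le (hκ : Summable fun n => ‖κ n‖) (hx : Summable fun n => ‖x n‖) :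
    ∑' m, ‖∑' n, κ (m + n) * x n‖ ≤ (∑' n, ‖κ n‖) * ∑' n, ‖x n‖ := by
  have hs := summable_hankel_prod hκ hx
  have hp := hκ.mul_of_nonneg hx (fun _ => norm_nonneg _) fun _ => norm_nonneg _
  calc ∑' m, ‖∑' n, κ (m + n) * x n‖
      ≤ ∑' m, ∑' n, ‖κ (m + n)‖ * ‖x n‖ :=
        (summable_norm_hankel hκ hx).tsum_le_tsum (norm_hankel_le hκ hx) hs.prod
    _ = ∑' p : ℕ × ℕ, ‖κ (p.1 + p.2)‖ * ‖x p.2‖ := hs.tsum_prod.symm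
    _ ≤ ∑' p : ℕ × ℕ, ‖κ p.1‖ * ‖x p.2‖ :=
        tsum_comp_le_tsum_of_inj hp (fun _ => by positivity) hankelIndex_injective
    _ = (∑' n, ‖κ n‖) * ∑' n, ‖x n‖ := (hκ.tsum_mul_tsum hx hp).symm

end Hankel

section Tails

variable {E : Type*} [SeminormedAddCommGroup E] {x : ℕ → E}

theorem tendsto_tsum_norm_tail (x : ℕ → E) :
    Tendsto (fun k => ∑' n, ‖x (n + k)‖) atTop (𝓝 0) :=
  tendsto_sum_nat_add fun n => ‖x n‖

theorem sum_inv_sq_tail_le (k N : ℕ) :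
    ∑ n ∈ Finset.range N, (((n + k : ℕ) : ℝ) + 1)⁻¹ ^ 2 ≤ 2 / ((k : ℝ) + 1) := by
  refine le_trans (le_of_eq ?_) (sum_Ioo_inv_sq_le (α := ℝ) k (N + (k + 1)))
  have hIoo : Finset.Ioo k (N + (k + 1)) = Finset.Ico (0 + (k + 1)) (N + (k + 1)) := by
    ext; simp
  rw [hIoo, ← Finset.sum_Ico_add' (fun i : ℕ => ((i : ℝ) ^ 2)⁻¹), Finset.range_eq_Ico]
  refine Finset.sum_congr rfl fun n _ => ?_
  push_cast
  rw [inv_pow, add_assoc]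

theorem sq_tsum_norm_tail_le (hx : Summable fun n : ℕ => (((n : ℝ) + 1) * ‖x n‖) ^ 2) (k : ℕ) :
    (∑' n, ‖x (n + k)‖) ^ 2 ≤ (∑' n : ℕ, (((n : ℝ) + 1) * ‖x n‖) ^ 2) * (2 / ((k : ℝ) + 1)) := by
  set C := ∑' n : ℕ, (((n : ℝ) + 1) * ‖x n‖) ^ 2
  have hC : 0 ≤ C := tsum_nonneg fun _ => sq_nonneg _
  suffices ∑' n, ‖x (n + k)‖ ≤ √(C * (2 / ((k : ℝ) + 1))) from
    (Real.le_sqrt (tsum_nonneg fun _ => norm_nonneg _) (by positivity)).1 this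
  refine Real.tsum_le_of_sum_range_le (fun _ => norm_nonneg _) fun N => Real.le_sqrt_of_sq_le ?_
  have hweight : ∀ n, ‖x (n + k)‖ =
      ((((n + k : ℕ) : ℝ) + 1) * ‖x (n + k)‖) * (((n + k : ℕ) : ℝ) + 1)⁻¹ := fun n => by
    field_simp
  calc (∑ n ∈ Finset.range N, ‖x (n + k)‖) ^ 2
      ≤ (∑ n ∈ Finset.range N, ((((n + k : ℕ) : ℝ) + 1) * ‖x (n + k)‖) ^ 2) *
          ∑ n ∈ Finset.range N, (((n + k : ℕ) : ℝ) + 1)⁻¹ ^ 2 := by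
        rw [Finset.sum_congr rfl fun n _ => hweight n]
        exact Finset.sum_mul_sq_le_sq_mul_sq _ _ _
    _ ≤ C * (2 / ((k : ℝ) + 1)) := by
        refine mul_le_mul ?_ (sum_inv_sq_tail_le k N) (Finset.sum_nonneg fun _ _ => sq_nonneg _) hC
        exact (((summable_nat_add_iff k).2 hx).sum_le_tsum _ fun _ _ => sq_nonneg _).trans
          (tsum_comp_le_tsum_of_inj hx (fun _ => sq_nonneg _) (add_left_injective k))

theorem summable_tsum_norm_tail_pow_three
    (hx : Summable fun n : ℕ => (((n : ℝ) + 1) * ‖x n‖) ^ 2) :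
    Summable fun k => (∑' n, ‖x (n + k)‖) ^ 3 := by
  set C := ∑' n : ℕ, (((n : ℝ) + 1) * ‖x n‖) ^ 2
  have hC : 0 ≤ C := tsum_nonneg fun _ => sq_nonneg _
  have htail : ∀ k, 0 ≤ ∑' n, ‖x (n + k)‖ := fun k => tsum_nonneg fun _ => norm_nonneg _
  have hmajor : Summable fun k : ℕ => (2 * C) ^ (3 / 2 : ℝ) * (((k + 1 : ℕ) : ℝ) ^ (3 / 2 : ℝ))⁻¹ :=
    ((summable_nat_add_iff 1).2 (Real.summable_nat_rpow_inv.2 (by norm_num))).mul_left _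
  refine .of_nonneg_of_le (fun k => pow_nonneg (htail k) 3) (fun k => ?_) hmajor
  calc (∑' n, ‖x (n + k)‖) ^ 3 = ((∑' n, ‖x (n + k)‖) ^ 2) ^ (3 / 2 : ℝ) := by
        rw [← Real.rpow_natCast _ 2, ← Real.rpow_mul (htail k), ← Real.rpow_natCast]
        norm_num
    _ ≤ (C * (2 / ((k : ℝ) + 1))) ^ (3 / 2 : ℝ) := by
        gcongr
        exact sq_tsum_norm_tail_le hx k
    _ = (2 * C) ^ (3 / 2 : ℝ) * (((k + 1 : ℕ) : ℝ) ^ (3 / 2 : ℝ))⁻¹ := by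
        rw [← Real.inv_rpow (by positivity),
          ← Real.mul_rpow (mul_nonneg zero_le_two hC) (by positivity)]
        push_cast
        congr 1
        ring

end Tails

/-! ### Power series with absolutely summable coefficients on the closed disk -/

section PowerSum

variable {R : Type*} [NormedCommRing R]

/-- The sum of the power series with coefficients `a`, meant for absolutely summable `a` on the
closed unit disk. -/
noncomputable def powerSum (a : ℕ → R) (z : R) : R := ∑' n, a n * z ^ n

variable [NormOneClass R]

theorem norm_mul_pow_le_norm {z : R} (hz : ‖z‖ ≤ 1) (c : R) (n : ℕ) : ‖c * z ^ n‖ ≤ ‖c‖ :=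
  (norm_mul_le _ _).trans <| mul_le_of_le_one_right (norm_nonneg _) <|
    (norm_pow_le z n).trans (pow_le_one₀ (norm_nonneg _) hz)

theorem norm_powerSum_le {a : ℕ → R} (ha : Summable fun n => ‖a n‖) {z : R} (hz : ‖z‖ ≤ 1) :
    ‖powerSum a z‖ ≤ ∑' n, ‖a n‖ :=
  tsum_of_norm_bounded ha.hasSum fun n => norm_mul_pow_le_norm hz (a n) n

variable [CompleteSpace R]

theorem summable_powerSum {a : ℕ → R} (ha : Summable fun n => ‖a n‖) {z : R} (hz : ‖z‖ ≤ 1) :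
    Summable fun n => a n * z ^ n :=
  .of_norm_bounded ha fun n => norm_mul_pow_le_norm hz (a n) n

theorem powerSum_eq_add_mul_powerSum_succ {a : ℕ → R} (ha : Summable fun n => ‖a n‖) {z : R}
    (hz : ‖z‖ ≤ 1) : powerSum a z = a 0 + z * powerSum (fun n => a (n + 1)) z := by
  have hsucc : Summable fun n => ‖a (n + 1)‖ := (summable_nat_add_iff 1).2 ha
  rw [powerSum, (summable_powerSum ha hz).tsum_eq_zero_add, pow_zero, mul_one, powerSum,
    ← (summable_powerSum hsucc hz).tsum_mul_left]
  exact congrArg _ (tsum_congr fun n => by ring)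

theorem powerSum_add_const_mul {a b : ℕ → R} (ha : Summable fun n => ‖a n‖)
    (hb : Summable fun n => ‖b n‖) (c : R) {z : R} (hz : ‖z‖ ≤ 1) :
    powerSum (fun n => a n + c * b n) z = powerSum a z + c * powerSum b z := by
  have sb := summable_powerSum hb hz
  simp_rw [powerSum, add_mul, mul_assoc]
  rw [(summable_powerSum ha hz).tsum_add (sb.mul_left c), sb.tsum_mul_left]

end PowerSum

/-! ### Spinors and the Bloch recursion -/

/-- The squared Euclidean length of a spinor; the norm of `ℂ × ℂ` itself is the sup norm. -/
noncomputable def spinorNormSq (s : ℂ × ℂ) : ℝ := Complex.normSq s.1 + Complex.normSq s.2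

/-- The Hopf map: the point of the sphere with homogeneous coordinates `s`, whose stereographic
projection from the south pole is `s.2 / s.1`. -/
noncomputable def hopf (s : ℂ × ℂ) : Fin 3 → ℝ :=
  ![2 * (conj s.1 * s.2).re / spinorNormSq s, 2 * (conj s.1 * s.2).im / spinorNormSq s,
    (Complex.normSq s.1 - Complex.normSq s.2) / spinorNormSq s]

/-- The action on spinors of a hard pulse with parameter `γ` followed by free precession by `z`. -/
noncomputable def spinorStep (γ z : ℂ) (s : ℂ × ℂ) : ℂ × ℂ :=
  (s.1 - conj γ * s.2, z * (s.2 + γ * s.1))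

theorem spinorNormSq_smul (k : ℂ) (s : ℂ × ℂ) :
    spinorNormSq (k • s) = Complex.normSq k * spinorNormSq s := by
  simp only [spinorNormSq, Prod.smul_fst, Prod.smul_snd, smul_eq_mul, map_mul, mul_add]

theorem spinorNormSq_pos {s : ℂ × ℂ} (hs : s ≠ 0) : 0 < spinorNormSq s := by
  have hor : s.1 ≠ 0 ∨ s.2 ≠ 0 := by simpa [Prod.ext_iff, or_iff_not_imp_left] using hs
  rcases hor with h | h
  · exact add_pos_of_pos_of_nonneg (Complex.normSq_pos.2 h) (Complex.normSq_nonneg _)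
  · exact add_pos_of_nonneg_of_pos (Complex.normSq_nonneg _) (Complex.normSq_pos.2 h)

theorem spinorNormSq_spinorStep (γ : ℂ) {z : ℂ} (hz : ‖z‖ = 1) (s : ℂ × ℂ) :
    spinorNormSq (spinorStep γ z s) = (1 + ‖γ‖ ^ 2) * spinorNormSq s := by
  have hz' : Complex.normSq z = 1 := by rw [Complex.normSq_eq_norm_sq, hz, one_pow]
  rw [spinorNormSq, spinorStep, map_mul, hz', one_mul, ← Complex.normSq_eq_norm_sq]
  simp only [spinorNormSq, Complex.normSq_apply, Complex.sub_re, Complex.sub_im, Complex.add_re,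
    Complex.add_im, Complex.mul_re, Complex.mul_im, Complex.conj_re, Complex.conj_im]
  ring

theorem one_add_conj_mul_self_ne_zero (γ : ℂ) : 1 + conj γ * γ ≠ 0 := by
  rw [← Complex.normSq_eq_conj_mul_self]
  exact_mod_cast (add_pos_of_pos_of_nonneg one_pos (Complex.normSq_nonneg γ)).ne'

theorem spinorStep_eq_zero_iff (γ : ℂ) {z : ℂ} (hz : z ≠ 0) {s : ℂ × ℂ} :
    spinorStep γ z s = 0 ↔ s = 0 := by
  simp only [spinorStep, Prod.ext_iff, Prod.fst_zero, Prod.snd_zero, mul_eq_zero, hz, false_or]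
  refine ⟨fun ⟨h1, h2⟩ => ?_, fun ⟨h1, h2⟩ => by simp [h1, h2]⟩
  have hs1 : (1 + conj γ * γ) * s.1 = 0 := by linear_combination h1 + conj γ * h2
  have hs2 : (1 + conj γ * γ) * s.2 = 0 := by linear_combination h2 - γ * h1
  have hγ := one_add_conj_mul_self_ne_zero γ
  exact ⟨(mul_eq_zero.1 hs1).resolve_left hγ, (mul_eq_zero.1 hs2).resolve_left hγ⟩

theorem hopf_smul {k : ℂ} (hk : k ≠ 0) (s : ℂ × ℂ) : hopf (k • s) = hopf s := by
  have h : Complex.normSq k ≠ 0 := (Complex.normSq_pos.2 hk).ne'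
  have hconj : conj (k • s).1 * (k • s).2 = (Complex.normSq k : ℂ) * (conj s.1 * s.2) := by
    rw [Prod.smul_fst, Prod.smul_snd, smul_eq_mul, smul_eq_mul, map_mul,
      Complex.normSq_eq_conj_mul_self]
    ring
  rw [hopf, hopf, hconj, spinorNormSq_smul, Complex.re_ofReal_mul, Complex.im_ofReal_mul,
    Prod.smul_fst, Prod.smul_snd, smul_eq_mul, smul_eq_mul, map_mul, map_mul, ← mul_sub,
    mul_left_comm, mul_left_comm 2 (Complex.normSq k), mul_div_mul_left _ _ h,
    mul_div_mul_left _ _ h, mul_div_mul_left _ _ h]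

theorem hopf_eq_hopf_one_div {s : ℂ × ℂ} (hs : s.1 ≠ 0) : hopf s = hopf (1, s.2 / s.1) := by
  rw [← hopf_smul hs (1, s.2 / s.1), Prod.smul_mk, smul_eq_mul, smul_eq_mul, mul_one,
    mul_div_cancel₀ _ hs]

theorem hopf_one_zero : hopf (1, 0) = ![0, 0, 1] := by
  simp [hopf, spinorNormSq]

theorem continuousAt_hopf {s : ℂ × ℂ} (hs : s ≠ 0) : ContinuousAt hopf s := by
  have hN : ContinuousAt spinorNormSq s := by unfold spinorNormSq; fun_prop
  have hN0 := (spinorNormSq_pos hs).ne'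
  refine continuousAt_pi.2 fun i => ?_
  fin_cases i
  · exact ContinuousAt.div (f := fun s : ℂ × ℂ => 2 * (conj s.1 * s.2).re) (by fun_prop) hN hN0
  · exact ContinuousAt.div (f := fun s : ℂ × ℂ => 2 * (conj s.1 * s.2).im) (by fun_prop) hN hN0
  · exact ContinuousAt.div (f := fun s : ℂ × ℂ => Complex.normSq s.1 - Complex.normSq s.2)
      (by fun_prop) hN hN0

theorem precession_eq (w : Circle) (v : Fin 3 → ℝ) :
    precession w v = ![(w : ℂ).re * v 0 - (w : ℂ).im * v 1,
      (w : ℂ).re * v 1 + (w : ℂ).im * v 0, v 2] := by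
  simp [precession]

theorem precession_sub (w : Circle) (u v : Fin 3 → ℝ) :
    precession w (u - v) = precession w u - precession w v := by
  ext i
  fin_cases i <;> simp [precession_eq] <;> ring

theorem precession_precession (w w' : Circle) (v : Fin 3 → ℝ) :
    precession w (precession w' v) = precession (w * w') v := by
  ext i
  fin_cases i <;> simp [precession_eq] <;> ring

theorem precession_one (v : Fin 3 → ℝ) : precession 1 v = v := by
  ext i
  fin_cases i <;> simp [precession_eq]

theorem precession_dotProduct_self (w : Circle) (v : Fin 3 → ℝ) :
    precession w v ⬝ᵥ precession w v = v ⬝ᵥ v := by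
  have hw : Complex.normSq (w : ℂ) = 1 := Circle.normSq_coe w
  rw [Complex.normSq_apply] at hw
  rw [precession_eq, Matrix.vec3_dotProduct, Matrix.vec3_dotProduct]
  simp only [Matrix.cons_val_zero, Matrix.cons_val_one, Matrix.cons_val]
  linear_combination (v 0 ^ 2 + v 1 ^ 2) * hw

theorem precession_hopf (w : Circle) (s : ℂ × ℂ) : precession w (hopf s) = hopf (s.1, w * s.2) := by
  have hw : Complex.normSq (w : ℂ) = 1 := Circle.normSq_coe w
  ext i
  fin_cases i <;> (simp [precession_eq, hopf, spinorNormSq, hw]; try ring)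

theorem pulseRotation_eq (c : ℂ) (v : Fin 3 → ℝ) :
    pulseRotation c v =
      ![Real.cos ‖c‖ * v 0 + Real.sin ‖c‖ * (c.im / ‖c‖ * v 2)
          + (1 - Real.cos ‖c‖) * (c.re / ‖c‖ * v 0 + c.im / ‖c‖ * v 1) * (c.re / ‖c‖),
        Real.cos ‖c‖ * v 1 - Real.sin ‖c‖ * (c.re / ‖c‖ * v 2)
          + (1 - Real.cos ‖c‖) * (c.re / ‖c‖ * v 0 + c.im / ‖c‖ * v 1) * (c.im / ‖c‖),
        Real.cos ‖c‖ * v 2 + Real.sin ‖c‖ * (c.re / ‖c‖ * v 1 - c.im / ‖c‖ * v 0)] := by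
  simp only [pulseRotation, cross_apply, Matrix.vec3_dotProduct]
  ext i
  fin_cases i <;> (simp [Pi.add_apply, Pi.smul_apply, -Matrix.smul_cons]; try ring)

theorem pulseRotation_zero (v : Fin 3 → ℝ) : pulseRotation 0 v = v := by
  simp [pulseRotation]

theorem pulseRotation_sub (c : ℂ) (u v : Fin 3 → ℝ) :
    pulseRotation c (u - v) = pulseRotation c u - pulseRotation c v := by
  ext i
  fin_cases i <;> simp [pulseRotation_eq] <;> ring

theorem sq_re_div_norm_add_sq_im_div_norm {c : ℂ} (hc : c ≠ 0) :
    (c.re / ‖c‖) ^ 2 + (c.im / ‖c‖) ^ 2 = 1 := by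
  have hc' : ‖c‖ ^ 2 ≠ 0 := pow_ne_zero 2 (norm_ne_zero_iff.2 hc)
  rw [div_pow, div_pow, ← add_div, div_eq_one_iff_eq hc', Complex.sq_norm, Complex.normSq_apply]
  ring

theorem pulseRotation_dotProduct_self (c : ℂ) (v : Fin 3 → ℝ) :
    pulseRotation c v ⬝ᵥ pulseRotation c v = v ⬝ᵥ v := by
  rcases eq_or_ne c 0 with rfl | hc
  · rw [pulseRotation_zero]
  have hn := sq_re_div_norm_add_sq_im_div_norm hc
  have hcs := Real.cos_sq_add_sin_sq ‖c‖
  rw [pulseRotation_eq, Matrix.vec3_dotProduct, Matrix.vec3_dotProduct]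
  generalize c.re / ‖c‖ = p at *
  generalize c.im / ‖c‖ = q at *
  generalize Real.cos ‖c‖ = C at *
  generalize Real.sin ‖c‖ = S at *
  simp only [Matrix.cons_val_zero, Matrix.cons_val_one, Matrix.cons_val]
  linear_combination (v 0 ^ 2 + v 1 ^ 2 + v 2 ^ 2 - (p * v 0 + q * v 1) ^ 2) * hcs
    + (S ^ 2 * (v 0 ^ 2 + v 1 ^ 2 + v 2 ^ 2)
      + (1 - C) ^ 2 * (p * v 0 + q * v 1) ^ 2) * hn

/-- The parameter `-i e^{i arg c} tan (|c| / 2)` with which the pulse `c` acts on spinors. -/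
noncomputable def pulseParam (c : ℂ) : ℂ := -Complex.I * (c / ‖c‖) * Real.tan (‖c‖ / 2)

theorem pulseParam_zero : pulseParam 0 = 0 := by
  simp [pulseParam]

theorem pulseParam_eq (c : ℂ) :
    pulseParam c =
      ⟨c.im / ‖c‖ * Real.tan (‖c‖ / 2), -(c.re / ‖c‖ * Real.tan (‖c‖ / 2))⟩ := by
  rw [pulseParam]
  generalize Real.tan (‖c‖ / 2) = t
  apply Complex.ext <;> simp [Complex.div_ofReal_re, Complex.div_ofReal_im]

theorem norm_pulseParam {c : ℂ} (hc : ‖c‖ < Real.pi) : ‖pulseParam c‖ = Real.tan (‖c‖ / 2) := by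
  rcases eq_or_ne c 0 with rfl | h
  · simp [pulseParam]
  · have htan : 0 ≤ Real.tan (‖c‖ / 2) :=
      Real.tan_nonneg_of_nonneg_of_le_pi_div_two (by positivity) (by linarith)
    rw [pulseParam, norm_mul, norm_mul, norm_neg, Complex.norm_I, norm_div, Complex.norm_real,
      Complex.norm_real, norm_norm, div_self (norm_ne_zero_iff.2 h), one_mul, one_mul,
      Real.norm_of_nonneg htan]

theorem cos_norm_ne_neg_one {c : ℂ} (hc : ‖c‖ < Real.pi) : Real.cos ‖c‖ ≠ -1 := by
  rw [← Real.cos_pi]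
  exact (Real.cos_lt_cos_of_nonneg_of_le_pi (norm_nonneg c) le_rfl hc).ne'

theorem pulseRotation_hopf {c : ℂ} (hc : ‖c‖ < Real.pi) {s : ℂ × ℂ} (hs : s ≠ 0) :
    pulseRotation c (hopf s) = hopf (spinorStep (pulseParam c) 1 s) := by
  rcases eq_or_ne c 0 with rfl | h0
  · simp [pulseRotation_zero, pulseParam_zero, spinorStep]
  have hn := sq_re_div_norm_add_sq_im_div_norm h0
  have hstep := spinorNormSq_spinorStep (pulseParam c) norm_one s
  rw [norm_pulseParam hc] at hstep
  rw [pulseRotation_eq, hopf, hopf, hstep, spinorStep, pulseParam_eq,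
    Real.cos_eq_two_mul_tan_half_div_one_sub_tan_half_sq _ (cos_norm_ne_neg_one hc),
    Real.sin_eq_two_mul_tan_half_div_one_add_tan_half_sq]
  have hN0 := (spinorNormSq_pos hs).ne'
  generalize Real.tan (‖c‖ / 2) = t at *
  generalize c.re / ‖c‖ = p at *
  generalize c.im / ‖c‖ = q at *
  generalize spinorNormSq s = N at *
  have ht : 1 + t ^ 2 ≠ 0 := by positivity
  ext i
  fin_cases i <;> simp only [Fin.zero_eta, Fin.mk_one, Fin.reduceFinMk, Matrix.cons_val,
    Matrix.cons_val_zero, Matrix.cons_val_one, Complex.normSq_apply, Complex.mul_re, Complex.mul_im,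
    Complex.conj_re, Complex.conj_im, Complex.add_re, Complex.add_im, Complex.sub_re,
    Complex.sub_im, map_sub, map_mul, Complex.conj_conj, one_mul]
  · field_simp
    linear_combination t ^ 2 * (s.1.re * s.2.re + s.1.im * s.2.im) * hn
  · field_simp
    linear_combination t ^ 2 * (s.1.re * s.2.im - s.1.im * s.2.re) * hn
  · field_simp
    linear_combination t ^ 2 * (s.1.re ^ 2 + s.1.im ^ 2 - (s.2.re ^ 2 + s.2.im ^ 2)) * hn

theorem precession_pulseRotation_hopf (w : Circle) {c : ℂ} (hc : ‖c‖ < Real.pi) {s : ℂ × ℂ}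
    (hs : s ≠ 0) :
    precession w (pulseRotation c (hopf s)) = hopf (spinorStep (pulseParam c) w s) := by
  rw [pulseRotation_hopf hc hs, precession_hopf, spinorStep, spinorStep, one_mul]

theorem stereographic_hopf_one (r : ℂ) :
    ((hopf (1, r) 0 : ℂ) + Complex.I * (hopf (1, r) 1 : ℂ)) / (1 + (hopf (1, r) 2 : ℂ)) = r := by
  have hN : (spinorNormSq (1, r) : ℂ) ≠ 0 := by
    exact_mod_cast (spinorNormSq_pos (s := (1, r)) (by simp)).ne'
  have hden : 1 + (hopf (1, r) 2 : ℂ) = 2 / spinorNormSq (1, r) := by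
    simp only [hopf, Matrix.cons_val]
    push_cast
    rw [eq_div_iff hN, add_mul, div_mul_cancel₀ _ hN]
    simp only [spinorNormSq, map_one]
    push_cast
    ring
  rw [hden, div_eq_iff (div_ne_zero two_ne_zero hN)]
  simp only [hopf, map_one, one_mul, Matrix.cons_val_zero, Matrix.cons_val_one]
  push_cast
  field_simp
  linear_combination Complex.re_add_im r

theorem fst_ne_zero_and_snd_div_fst_eq {s : ℂ × ℂ} (hs : s ≠ 0) {r : ℂ}
    (h : hopf s = hopf (1, r)) : s.1 ≠ 0 ∧ s.2 / s.1 = r := by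
  have hs1 : s.1 ≠ 0 := by
    intro h1
    have h2 : hopf s 2 = -1 := by
      have hN := (spinorNormSq_pos hs).ne'
      rw [spinorNormSq, h1, map_zero, zero_add] at hN
      simp [hopf, spinorNormSq, h1, neg_div, div_self hN]
    have h3 : hopf (1, r) 2 + 1 = 2 / spinorNormSq (1, r) := by
      have hN := (spinorNormSq_pos (s := (1, r)) (by simp)).ne'
      simp only [hopf, Matrix.cons_val]
      field_simp
      simp only [spinorNormSq, map_one]
      ring
    rw [← h, h2, neg_add_cancel] at h3
    exact (div_pos two_pos (spinorNormSq_pos (s := (1, r)) (by simp))).ne h3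
  refine ⟨hs1, ?_⟩
  rw [← stereographic_hopf_one (s.2 / s.1), ← hopf_eq_hopf_one_div hs1, h, stereographic_hopf_one]

theorem eq_hopf_one_reflectionCoeff {M : Circle → Fin 3 → ℝ} {w : Circle} (hM : M w ⬝ᵥ M w = 1)
    (hz : M w 2 ≠ -1) : M w = hopf (1, reflectionCoeff M w) := by
  have hz' : 1 + M w 2 ≠ 0 := fun h => hz (by linarith)
  rw [Matrix.vec3_dotProduct] at hM
  have hr : reflectionCoeff M w = ⟨M w 0 / (1 + M w 2), M w 1 / (1 + M w 2)⟩ := by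
    have hcast : (1 + (M w 2 : ℂ)) = ((1 + M w 2 : ℝ) : ℂ) := by push_cast; rfl
    rw [reflectionCoeff, hcast]
    apply Complex.ext
    · rw [Complex.div_ofReal_re]; simp
    · rw [Complex.div_ofReal_im]; simp
  have hN : spinorNormSq (1, reflectionCoeff M w) = 2 / (1 + M w 2) := by
    rw [spinorNormSq, map_one, hr, Complex.normSq_mk]
    field_simp
    linear_combination hM
  have hdiff : 1 - Complex.normSq (reflectionCoeff M w) = 2 * M w 2 / (1 + M w 2) := by
    have : 1 - Complex.normSq (reflectionCoeff M w)
        = 2 - spinorNormSq (1, reflectionCoeff M w) := by simp [spinorNormSq]; ring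
    rw [this, hN]
    field_simp
    ring
  rw [hopf, hN, map_one, map_one, hdiff, hr]
  ext i
  fin_cases i <;> simp <;> field_simp

/-! ### The Marchenko equations and layer stripping -/

/-- The discrete Marchenko equations with kernel `κ`, for a pair `p` of coefficient sequences
`a = p.1`, `b = p.2`: `b` is the conjugate of the Hankel transform of `a`, and `a` is, but for its
leading coefficient, minus the conjugate of the Hankel transform of `b`. -/
structure IsMarchenkoSolution (κ : ℕ → ℂ) (p : (ℕ → ℂ) × (ℕ → ℂ)) : Prop where
  summable_kernel : Summable fun n => ‖κ n‖
  summable_fst : Summable fun n => ‖p.1 n‖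
  summable_snd : Summable fun n => ‖p.2 n‖
  fst_zero_ne_zero : p.1 0 ≠ 0
  conj_snd : ∀ m, conj (p.2 m) = ∑' n, κ (m + n) * p.1 n
  conj_fst_succ : ∀ m, conj (p.1 (m + 1)) = -∑' n, κ (m + 1 + n) * p.2 n

/-- The parameter of the outermost pulse of the layered medium with data `p`. -/
noncomputable def schurParam (p : (ℕ → ℂ) × (ℕ → ℂ)) : ℂ := p.2 0 / p.1 0

/-- The scattering data which remain after the outermost pulse has been removed. -/
noncomputable def layerStrip (p : (ℕ → ℂ) × (ℕ → ℂ)) : (ℕ → ℂ) × (ℕ → ℂ) :=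
  (fun n => p.1 n + conj (schurParam p) * p.2 n, fun n => p.2 (n + 1) - schurParam p * p.1 (n + 1))

/-- The spinor `(A z, B z)` with `A = ∑ aₙ zⁿ` and `B = ∑ bₙ zⁿ⁺¹`, for `p = (a, b)`. -/
noncomputable def dataSpinor (p : (ℕ → ℂ) × (ℕ → ℂ)) (z : ℂ) : ℂ × ℂ :=
  (powerSum p.1 z, z * powerSum p.2 z)

namespace IsMarchenkoSolution

variable {κ : ℕ → ℂ} {p : (ℕ → ℂ) × (ℕ → ℂ)}

theorem schurParam_mul_fst_zero (h : IsMarchenkoSolution κ p) : schurParam p * p.1 0 = p.2 0 :=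
  div_mul_cancel₀ _ h.fst_zero_ne_zero

theorem summable_fst_succ (h : IsMarchenkoSolution κ p) : Summable fun n => ‖p.1 (n + 1)‖ :=
  (summable_nat_add_iff 1).2 h.summable_fst

theorem summable_snd_succ (h : IsMarchenkoSolution κ p) : Summable fun n => ‖p.2 (n + 1)‖ :=
  (summable_nat_add_iff 1).2 h.summable_snd

theorem layerStrip_fst_zero (h : IsMarchenkoSolution κ p) :
    (layerStrip p).1 0 = (1 + conj (schurParam p) * schurParam p) * p.1 0 := by
  rw [layerStrip]
  linear_combination -conj (schurParam p) * h.schurParam_mul_fst_zero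

theorem conj_layerStrip_snd (h : IsMarchenkoSolution κ p) (m : ℕ) :
    conj ((layerStrip p).2 m) = ∑' n, κ (m + n + 1) * (layerStrip p).1 n := by
  have ha := (summable_norm_hankel_row h.summable_kernel h.summable_fst (m + 1)).of_norm
  have hb := (summable_norm_hankel_row h.summable_kernel h.summable_snd (m + 1)).of_norm
  have hterm : ∀ n, κ (m + n + 1) * (layerStrip p).1 n
      = κ (m + 1 + n) * p.1 n + conj (schurParam p) * (κ (m + 1 + n) * p.2 n) := fun n => by
    rw [layerStrip, add_right_comm]
    ring
  rw [tsum_congr hterm, ha.tsum_add (hb.mul_left _), tsum_mul_left, ← h.conj_snd, layerStrip,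
    map_sub, map_mul, h.conj_fst_succ]
  ring

theorem conj_layerStrip_fst_succ (h : IsMarchenkoSolution κ p) (m : ℕ) :
    conj ((layerStrip p).1 (m + 1)) = -∑' n, κ (m + 1 + n + 1) * (layerStrip p).2 n := by
  have ha := (summable_norm_hankel_row h.summable_kernel h.summable_fst (m + 1)).of_norm
  have hb := (summable_norm_hankel_row h.summable_kernel h.summable_snd (m + 1)).of_norm
  have hterm : ∀ n, κ (m + 1 + n + 1) * (layerStrip p).2 n
      = κ (m + 1 + (n + 1)) * p.2 (n + 1) - schurParam p * (κ (m + 1 + (n + 1)) * p.1 (n + 1)) :=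
    fun n => by
      rw [layerStrip, add_assoc (m + 1)]
      ring
  have hconjb := h.conj_snd (m + 1)
  have hconja := h.conj_fst_succ m
  rw [ha.tsum_eq_zero_add] at hconjb
  rw [hb.tsum_eq_zero_add] at hconja
  rw [tsum_congr hterm, ((summable_nat_add_iff 1).2 hb).tsum_sub
    (((summable_nat_add_iff 1).2 ha).mul_left _), tsum_mul_left, layerStrip, map_add, map_mul,
    Complex.conj_conj, hconja, hconjb]
  linear_combination κ (m + 1 + 0) * h.schurParam_mul_fst_zero

theorem strip (h : IsMarchenkoSolution κ p) :
    IsMarchenkoSolution (fun n => κ (n + 1)) (layerStrip p) where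
  summable_kernel := (summable_nat_add_iff 1).2 h.summable_kernel
  summable_fst := .of_nonneg_of_le (fun _ => norm_nonneg _)
    (fun n => (norm_add_le _ _).trans_eq (congrArg _ (norm_mul _ _)))
    (h.summable_fst.add (h.summable_snd.mul_left _))
  summable_snd := .of_nonneg_of_le (fun _ => norm_nonneg _)
    (fun n => (norm_sub_le _ _).trans_eq (congrArg _ (norm_mul _ _)))
    (h.summable_snd_succ.add (h.summable_fst_succ.mul_left _))
  fst_zero_ne_zero := by
    rw [h.layerStrip_fst_zero]
    exact mul_ne_zero (one_add_conj_mul_self_ne_zero _) h.fst_zero_ne_zero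
  conj_snd := h.conj_layerStrip_snd
  conj_fst_succ := h.conj_layerStrip_fst_succ

theorem iterate_layerStrip (h : IsMarchenkoSolution κ p) (k : ℕ) :
    IsMarchenkoSolution (fun n => κ (n + k)) (layerStrip^[k] p) := by
  induction k with
  | zero => exact h
  | succ k ih =>
    rw [Function.iterate_succ_apply']
    simpa only [add_right_comm _ 1 k, add_assoc] using ih.strip

theorem tsum_norm_snd_le (h : IsMarchenkoSolution κ p) :
    ∑' n, ‖p.2 n‖ ≤ (∑' n, ‖κ n‖) * ∑' n, ‖p.1 n‖ := by
  refine le_of_eq_of_le ?_ (tsum_norm_hankel_le h.summable_kernel h.summable_fst)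
  simp_rw [← h.conj_snd, RCLike.norm_conj]

theorem tsum_norm_fst_succ_le (h : IsMarchenkoSolution κ p) :
    ∑' n, ‖p.1 (n + 1)‖ ≤ (∑' n, ‖κ n‖) * ∑' n, ‖p.2 n‖ := by
  have hnorm : ∀ m, ‖p.1 (m + 1)‖ = ‖∑' n, κ (m + 1 + n) * p.2 n‖ := fun m => by
    rw [← RCLike.norm_conj (p.1 (m + 1)), h.conj_fst_succ, norm_neg]
  calc ∑' n, ‖p.1 (n + 1)‖ = ∑' m, ‖∑' n, κ (m + 1 + n) * p.2 n‖ := tsum_congr hnorm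
    _ ≤ ∑' m, ‖∑' n, κ (m + n) * p.2 n‖ :=
      tsum_comp_le_tsum_of_inj (summable_norm_hankel h.summable_kernel h.summable_snd)
        (fun _ => norm_nonneg _) (add_left_injective 1)
    _ ≤ (∑' n, ‖κ n‖) * ∑' n, ‖p.2 n‖ := tsum_norm_hankel_le h.summable_kernel h.summable_snd

section SmallKernel

variable (h : IsMarchenkoSolution κ p) (hκ : ∑' n, ‖κ n‖ ≤ 1 / 2)

include h hκ

theorem tsum_norm_fst_le_two_mul : ∑' n, ‖p.1 n‖ ≤ 2 * ‖p.1 0‖ := by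
  have hsplit := h.summable_fst.tsum_eq_zero_add
  have htail : ∑' n, ‖p.1 (n + 1)‖ ≤ 1 / 2 * (1 / 2 * ∑' n, ‖p.1 n‖) :=
    calc ∑' n, ‖p.1 (n + 1)‖ ≤ (∑' n, ‖κ n‖) * ∑' n, ‖p.2 n‖ := h.tsum_norm_fst_succ_le
      _ ≤ (∑' n, ‖κ n‖) * ((∑' n, ‖κ n‖) * ∑' n, ‖p.1 n‖) := by
        gcongr
        exact h.tsum_norm_snd_le
      _ ≤ 1 / 2 * (1 / 2 * ∑' n, ‖p.1 n‖) := by gcongr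
  linarith [norm_nonneg (p.1 0)]

theorem tsum_norm_snd_le_mul_fst_zero :
    ∑' n, ‖p.2 n‖ ≤ 2 * (∑' n, ‖κ n‖) * ‖p.1 0‖ :=
  calc ∑' n, ‖p.2 n‖ ≤ (∑' n, ‖κ n‖) * ∑' n, ‖p.1 n‖ := h.tsum_norm_snd_le
    _ ≤ (∑' n, ‖κ n‖) * (2 * ‖p.1 0‖) := by
      gcongr
      exact h.tsum_norm_fst_le_two_mul hκ
    _ = 2 * (∑' n, ‖κ n‖) * ‖p.1 0‖ := by ring

theorem tsum_norm_fst_succ_le_mul_fst_zero :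
    ∑' n, ‖p.1 (n + 1)‖ ≤ 2 * (∑' n, ‖κ n‖) ^ 2 * ‖p.1 0‖ :=
  calc ∑' n, ‖p.1 (n + 1)‖ ≤ (∑' n, ‖κ n‖) * ∑' n, ‖p.2 n‖ := h.tsum_norm_fst_succ_le
    _ ≤ (∑' n, ‖κ n‖) * (2 * (∑' n, ‖κ n‖) * ‖p.1 0‖) := by
      gcongr
      exact h.tsum_norm_snd_le_mul_fst_zero hκ
    _ = 2 * (∑' n, ‖κ n‖) ^ 2 * ‖p.1 0‖ := by ring

theorem norm_schurParam_le : ‖schurParam p‖ ≤ ‖κ 0‖ + 2 * (∑' n, ‖κ n‖) ^ 3 := by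
  have hrow : Summable fun n => ‖κ n * p.1 n‖ := by
    simpa only [zero_add] using summable_norm_hankel_row h.summable_kernel h.summable_fst 0
  have hrow_succ : Summable fun n => ‖κ (n + 1) * p.1 (n + 1)‖ := (summable_nat_add_iff 1).2 hrow
  have htail : ‖∑' n, κ (n + 1) * p.1 (n + 1)‖ ≤ 2 * (∑' n, ‖κ n‖) ^ 3 * ‖p.1 0‖ :=
    calc ‖∑' n, κ (n + 1) * p.1 (n + 1)‖
        ≤ ∑' n, ‖κ (n + 1) * p.1 (n + 1)‖ := norm_tsum_le_tsum_norm hrow_succ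
      _ ≤ ∑' n, (∑' n, ‖κ n‖) * ‖p.1 (n + 1)‖ := by
        refine hrow_succ.tsum_le_tsum (fun n => ?_) (h.summable_fst_succ.mul_left _)
        rw [norm_mul]
        gcongr
        exact h.summable_kernel.le_tsum (n + 1) fun _ _ => norm_nonneg _
      _ = (∑' n, ‖κ n‖) * ∑' n, ‖p.1 (n + 1)‖ := tsum_mul_left
      _ ≤ (∑' n, ‖κ n‖) * (2 * (∑' n, ‖κ n‖) ^ 2 * ‖p.1 0‖) := by
        gcongr
        exact h.tsum_norm_fst_succ_le_mul_fst_zero hκ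
      _ = 2 * (∑' n, ‖κ n‖) ^ 3 * ‖p.1 0‖ := by ring
  have hsnd := h.conj_snd 0
  simp only [zero_add] at hsnd
  rw [schurParam, norm_div, div_le_iff₀ (norm_pos_iff.2 h.fst_zero_ne_zero),
    ← RCLike.norm_conj (p.2 0), hsnd, hrow.of_norm.tsum_eq_zero_add, add_mul, ← norm_mul]
  exact (norm_add_le _ _).trans (by gcongr)

variable {z : ℂ} (hz : ‖z‖ ≤ 1)

include hz

theorem half_norm_fst_zero_le_norm_powerSum : ‖p.1 0‖ / 2 ≤ ‖powerSum p.1 z‖ := by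
  have htail : ‖z * powerSum (fun n => p.1 (n + 1)) z‖ ≤ ‖p.1 0‖ / 2 :=
    calc ‖z * powerSum (fun n => p.1 (n + 1)) z‖
      _ ≤ 1 * ∑' n, ‖p.1 (n + 1)‖ := by
        rw [norm_mul]
        gcongr
        exact norm_powerSum_le h.summable_fst_succ hz
      _ ≤ 1 * (2 * (1 / 2) ^ 2 * ‖p.1 0‖) := by
        gcongr
        refine (h.tsum_norm_fst_succ_le_mul_fst_zero hκ).trans ?_
        gcongr
      _ = ‖p.1 0‖ / 2 := by ring
  rw [powerSum_eq_add_mul_powerSum_succ h.summable_fst hz]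
  linarith [norm_sub_le_norm_add (p.1 0) (z * powerSum (fun n => p.1 (n + 1)) z)]

theorem dataSpinor_fst_ne_zero : (dataSpinor p z).1 ≠ 0 := by
  have hpos : 0 < ‖p.1 0‖ := norm_pos_iff.2 h.fst_zero_ne_zero
  exact norm_pos_iff.1 ((half_pos hpos).trans_le (h.half_norm_fst_zero_le_norm_powerSum hκ hz))

theorem norm_dataSpinor_snd_div_fst_le :
    ‖(dataSpinor p z).2 / (dataSpinor p z).1‖ ≤ 4 * ∑' n, ‖κ n‖ := by
  rw [norm_div, div_le_iff₀ (norm_pos_iff.2 (h.dataSpinor_fst_ne_zero hκ hz))]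
  calc ‖z * powerSum p.2 z‖ ≤ 1 * ∑' n, ‖p.2 n‖ := by
        rw [norm_mul]
        gcongr
        exact norm_powerSum_le h.summable_snd hz
    _ ≤ 4 * (∑' n, ‖κ n‖) * (‖p.1 0‖ / 2) := by
        linarith [h.tsum_norm_snd_le_mul_fst_zero hκ]
    _ ≤ 4 * (∑' n, ‖κ n‖) * ‖powerSum p.1 z‖ := by
        gcongr
        exact h.half_norm_fst_zero_le_norm_powerSum hκ hz

end SmallKernel

theorem eventually_tsum_norm_tail_le_half (κ : ℕ → ℂ) :
    ∀ᶠ k in atTop, ∑' n, ‖κ (n + k)‖ ≤ 1 / 2 :=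
  (tendsto_tsum_norm_tail κ).eventually_le_const (by norm_num)

theorem summable_schurParam (h : IsMarchenkoSolution κ p)
    (hκ : Summable fun k => (∑' n, ‖κ (n + k)‖) ^ 3) :
    Summable fun k => ‖schurParam (layerStrip^[k] p)‖ := by
  obtain ⟨K, hK⟩ := eventually_atTop.1 (eventually_tsum_norm_tail_le_half κ)
  have hmajor : Summable fun k => ‖κ (k + K)‖ + 2 * (∑' n, ‖κ (n + (k + K))‖) ^ 3 :=
    ((summable_nat_add_iff K).2 h.summable_kernel).add
      (((summable_nat_add_iff K).2 hκ).mul_left 2)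
  refine (summable_nat_add_iff K).1 (.of_nonneg_of_le (fun _ => norm_nonneg _) (fun k => ?_) hmajor)
  simpa only [zero_add] using
    (h.iterate_layerStrip (k + K)).norm_schurParam_le (hK _ (Nat.le_add_left _ _))

section ClosedDisk

variable (h : IsMarchenkoSolution κ p) {z : ℂ} (hz : ‖z‖ ≤ 1)

include h hz

theorem spinorStep_dataSpinor_layerStrip :
    spinorStep (schurParam p) z (dataSpinor (layerStrip p) z)
      = (1 + conj (schurParam p) * schurParam p) • dataSpinor p z := by
  have hfst : powerSum (layerStrip p).1 z
      = powerSum p.1 z + conj (schurParam p) * powerSum p.2 z :=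
    powerSum_add_const_mul h.summable_fst h.summable_snd _ hz
  have hsnd : powerSum (layerStrip p).2 z = powerSum (fun n => p.2 (n + 1)) z
      + -schurParam p * powerSum (fun n => p.1 (n + 1)) z := by
    rw [← powerSum_add_const_mul h.summable_snd_succ h.summable_fst_succ _ hz]
    simp only [layerStrip, sub_eq_add_neg, neg_mul]
  have ha := powerSum_eq_add_mul_powerSum_succ h.summable_fst hz
  have hb := powerSum_eq_add_mul_powerSum_succ h.summable_snd hz
  have hstrip : z * powerSum (layerStrip p).2 z
      = powerSum p.2 z - schurParam p * powerSum p.1 z := by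
    rw [hsnd, ha, hb]
    linear_combination h.schurParam_mul_fst_zero
  simp only [spinorStep, dataSpinor, hstrip, hfst, Prod.smul_mk, smul_eq_mul, Prod.mk.injEq]
  constructor <;> ring

theorem dataSpinor_iterate_layerStrip_ne_zero (hz0 : z ≠ 0) (h0 : dataSpinor p z ≠ 0) (k : ℕ) :
    dataSpinor (layerStrip^[k] p) z ≠ 0 := by
  induction k with
  | zero => exact h0
  | succ k ih =>
    rw [Function.iterate_succ_apply', Ne, ← spinorStep_eq_zero_iff _ hz0,
      (h.iterate_layerStrip k).spinorStep_dataSpinor_layerStrip hz]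
    exact smul_ne_zero (one_add_conj_mul_self_ne_zero _) ih

theorem tendsto_dataSpinor_snd_div_fst :
    Tendsto (fun k => (dataSpinor (layerStrip^[k] p) z).2 /
      (dataSpinor (layerStrip^[k] p) z).1) atTop (𝓝 0) := by
  have hlim := (tendsto_tsum_norm_tail κ).const_mul 4
  rw [mul_zero] at hlim
  exact squeeze_zero_norm' ((eventually_tsum_norm_tail_le_half κ).mono fun k hk =>
    (h.iterate_layerStrip k).norm_dataSpinor_snd_div_fst_le hk hz) hlim

theorem tendsto_hopf_dataSpinor :
    Tendsto (fun k => hopf (dataSpinor (layerStrip^[k] p) z)) atTop (𝓝 ![0, 0, 1]) := by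
  have hlim := (continuousAt_hopf (s := (1, 0)) (by simp)).tendsto.comp
    ((tendsto_const_nhds (x := (1 : ℂ))).prodMk_nhds (h.tendsto_dataSpinor_snd_div_fst hz))
  rw [hopf_one_zero] at hlim
  refine hlim.congr' ((eventually_tsum_norm_tail_le_half κ).mono fun k hk => ?_)
  exact (hopf_eq_hopf_one_div ((h.iterate_layerStrip k).dataSpinor_fst_ne_zero hk hz)).symm

end ClosedDisk

end IsMarchenkoSolution

/-! ### Pulses with prescribed parameters -/

/-- The pulse with spinor parameter `γ`, inverse to `pulseParam`. -/
noncomputable def pulseOfParam (γ : ℂ) : ℂ :=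
  Complex.I * (γ / ‖γ‖) * ((2 * Real.arctan ‖γ‖ : ℝ) : ℂ)

theorem norm_pulseOfParam (γ : ℂ) : ‖pulseOfParam γ‖ = 2 * Real.arctan ‖γ‖ := by
  rcases eq_or_ne γ 0 with rfl | h
  · simp [pulseOfParam]
  · have harctan : 0 ≤ Real.arctan ‖γ‖ := Real.arctan_nonneg.2 (norm_nonneg _)
    rw [pulseOfParam, norm_mul, norm_mul, Complex.norm_I, norm_div, Complex.norm_real,
      Complex.norm_real, norm_norm, div_self (norm_ne_zero_iff.2 h), one_mul, one_mul,
      Real.norm_of_nonneg (mul_nonneg zero_le_two harctan)]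

theorem norm_pulseOfParam_lt_pi (γ : ℂ) : ‖pulseOfParam γ‖ < Real.pi := by
  rw [norm_pulseOfParam]
  linarith [Real.arctan_lt_pi_div_two ‖γ‖]

theorem norm_pulseOfParam_le (γ : ℂ) : ‖pulseOfParam γ‖ ≤ 2 * ‖γ‖ := by
  rw [norm_pulseOfParam]
  gcongr
  rcases (norm_nonneg γ).eq_or_lt with h | h
  · rw [← h, Real.arctan_zero]
  · simpa only [Real.tan_arctan] using
      (Real.lt_tan (Real.arctan_pos.2 h) (Real.arctan_lt_pi_div_two _)).le

theorem pulseParam_pulseOfParam (γ : ℂ) : pulseParam (pulseOfParam γ) = γ := by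
  rcases eq_or_ne γ 0 with rfl | h
  · simp [pulseOfParam, pulseParam]
  · have hγ : (‖γ‖ : ℂ) ≠ 0 := by exact_mod_cast norm_ne_zero_iff.2 h
    have harctan : ((2 * Real.arctan ‖γ‖ : ℝ) : ℂ) ≠ 0 := by
      exact_mod_cast (mul_pos two_pos (Real.arctan_pos.2 (norm_pos_iff.2 h))).ne'
    rw [pulseParam, norm_pulseOfParam, pulseOfParam, mul_div_assoc, div_self harctan,
      mul_div_cancel_left₀ _ two_ne_zero, Real.tan_arctan]
    field_simp
    rw [Complex.I_sq]
    ring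

theorem sub_one_sub_natCast_injective (ρ : ℤ) : Function.Injective fun k : ℕ => ρ - 1 - (k : ℤ) :=
  fun m n h => by simpa using h

theorem hasSum_int_iff_of_eq_zero {E : Type*} [AddCommMonoid E] [TopologicalSpace E] {f : ℤ → E}
    {ρ : ℤ} (hf : ∀ j, ρ ≤ j → f j = 0) {s : E} :
    HasSum f s ↔ HasSum (fun k : ℕ => f (ρ - 1 - k)) s := by
  refine ((sub_one_sub_natCast_injective ρ).hasSum_iff fun j hj => hf j ?_).symm
  by_contra hlt
  exact hj ⟨(ρ - 1 - j).toNat, by dsimp only; omega⟩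

/-- The hard pulse with `ρ` rephasing time steps and spinor parameters `γ 0, γ 1, …` listed
backwards in time. -/
noncomputable def pulseOfParams (ρ : ℤ) (γ : ℕ → ℂ) (j : ℤ) : ℂ :=
  if j < ρ then pulseOfParam (γ (ρ - 1 - j).toNat) else 0

theorem pulseOfParams_of_le {ρ j : ℤ} (hj : ρ ≤ j) (γ : ℕ → ℂ) : pulseOfParams ρ γ j = 0 :=
  if_neg hj.not_gt

theorem pulseOfParams_sub_one_sub (ρ : ℤ) (γ : ℕ → ℂ) (k : ℕ) :
    pulseOfParams ρ γ (ρ - 1 - k) = pulseOfParam (γ k) := by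
  rw [pulseOfParams, if_pos (by omega), sub_sub_cancel, Int.toNat_natCast]

theorem norm_pulseOfParams_lt_pi (ρ : ℤ) (γ : ℕ → ℂ) (j : ℤ) : ‖pulseOfParams ρ γ j‖ < Real.pi := by
  rw [pulseOfParams]
  split_ifs
  · exact norm_pulseOfParam_lt_pi _
  · simpa using Real.pi_pos

theorem summable_norm_pulseOfParams (ρ : ℤ) {γ : ℕ → ℂ} (hγ : Summable fun k => ‖γ k‖) :
    Summable fun j => ‖pulseOfParams ρ γ j‖ := by
  have hback : Summable fun k : ℕ => ‖pulseOfParams ρ γ (ρ - 1 - k)‖ := by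
    simp only [pulseOfParams_sub_one_sub]
    exact .of_nonneg_of_le (fun _ => norm_nonneg _) (fun k => norm_pulseOfParam_le _)
      (hγ.mul_left 2)
  exact ((hasSum_int_iff_of_eq_zero (f := fun j => ‖pulseOfParams ρ γ j‖) fun j hj => by
    rw [pulseOfParams_of_le hj, norm_zero]).2 hback.hasSum).summable

/-- The magnetization which is `S k` before the last `k` pulses and precesses freely after time
`ρ`. -/
noncomputable def reversedMagnetization (ρ : ℤ) (w : Circle) (S : ℕ → Fin 3 → ℝ) (j : ℤ) :
    Fin 3 → ℝ :=
  if j < ρ then S (ρ - j).toNat else precession (w ^ (j - ρ)) (S 0)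

theorem reversedMagnetization_of_le {ρ j : ℤ} (hj : ρ ≤ j) (w : Circle) (S : ℕ → Fin 3 → ℝ) :
    reversedMagnetization ρ w S j = precession (w ^ (j - ρ)) (S 0) :=
  if_neg hj.not_gt

theorem reversedMagnetization_sub_natCast (ρ : ℤ) (w : Circle) (S : ℕ → Fin 3 → ℝ) (k : ℕ) :
    reversedMagnetization ρ w S (ρ - k) = S k := by
  rw [reversedMagnetization]
  split_ifs with hk
  · rw [sub_sub_cancel, Int.toNat_natCast]
  · obtain rfl : k = 0 := by omega
    rw [Nat.cast_zero, sub_zero, sub_self, zpow_zero, precession_one]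

theorem reversedMagnetization_add_one {ρ : ℤ} {w : Circle} {γ : ℕ → ℂ} {S : ℕ → Fin 3 → ℝ}
    (hS : ∀ k, S k = precession w (pulseRotation (pulseOfParam (γ k)) (S (k + 1)))) (j : ℤ) :
    reversedMagnetization ρ w S (j + 1) =
      precession w (pulseRotation (pulseOfParams ρ γ j) (reversedMagnetization ρ w S j)) := by
  rcases lt_or_ge j ρ with hj | hj
  · obtain ⟨k, rfl⟩ : ∃ k : ℕ, j = ρ - 1 - k := ⟨(ρ - 1 - j).toNat, by omega⟩
    have hnext : ρ - 1 - (k : ℤ) + 1 = ρ - k := by ring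
    have hprev : ρ - 1 - (k : ℤ) = ρ - (k + 1 : ℕ) := by push_cast; ring
    rw [hnext, reversedMagnetization_sub_natCast, pulseOfParams_sub_one_sub, hprev,
      reversedMagnetization_sub_natCast]
    exact hS k
  · have hexp : j + 1 - ρ = 1 + (j - ρ) := by ring
    rw [reversedMagnetization_of_le hj, reversedMagnetization_of_le (by omega),
      pulseOfParams_of_le hj, pulseRotation_zero, precession_precession, hexp, zpow_add, zpow_one]

theorem tendsto_reversedMagnetization_atBot (ρ : ℤ) (w : Circle) {S : ℕ → Fin 3 → ℝ}
    {v : Fin 3 → ℝ} (hS : Tendsto S atTop (𝓝 v)) :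
    Tendsto (reversedMagnetization ρ w S) atBot (𝓝 v) := by
  have htoNat : Tendsto (fun j : ℤ => (ρ - j).toNat) atBot atTop := by
    refine tendsto_atTop.2 fun n => ?_
    filter_upwards [eventually_le_atBot (ρ - n)] with j hj
    omega
  refine (hS.comp htoNat).congr' ?_
  filter_upwards [eventually_lt_atBot ρ] with j hj
  rw [Function.comp_apply, reversedMagnetization, if_pos hj]

theorem tendsto_precession_reversedMagnetization_atTop (ρ : ℤ) (w : Circle)
    (S : ℕ → Fin 3 → ℝ) :
    Tendsto (fun j => precession (w ^ (-j)) (reversedMagnetization ρ w S j)) atTop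
      (𝓝 (precession (w ^ (-ρ)) (S 0))) := by
  refine tendsto_const_nhds.congr' ?_
  filter_upwards [eventually_ge_atTop ρ] with j hj
  rw [reversedMagnetization_of_le hj, precession_precession, ← zpow_add]
  congr 2
  ring

theorem isRephasedPulse_pulseOfParams {ρ : ℤ} {γ : ℕ → ℂ} (hγ : Summable fun k => ‖γ k‖)
    {M : Circle → Fin 3 → ℝ} {S : Circle → ℕ → Fin 3 → ℝ}
    (hS : ∀ w k, S w k = precession w (pulseRotation (pulseOfParam (γ k)) (S w (k + 1))))
    (hlim : ∀ w, Tendsto (S w) atTop (𝓝 ![0, 0, 1]))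
    (hM : ∀ w, M w = precession (w ^ (-ρ)) (S w 0)) :
    IsRephasedPulse ρ M (pulseOfParams ρ γ) where
  summable := summable_norm_pulseOfParams ρ hγ
  norm_lt_pi := norm_pulseOfParams_lt_pi ρ γ
  rephasing _ hj := pulseOfParams_of_le hj γ
  transform w := ⟨reversedMagnetization ρ w (S w), reversedMagnetization_add_one (hS w),
    tendsto_reversedMagnetization_atBot ρ w (hlim w),
    hM w ▸ tendsto_precession_reversedMagnetization_atTop ρ w (S w)⟩

namespace IsMarchenkoSolution

variable {κ : ℕ → ℂ} {p : (ℕ → ℂ) × (ℕ → ℂ)}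

theorem hopf_dataSpinor_iterate_layerStrip (h : IsMarchenkoSolution κ p) {w : Circle}
    (h0 : dataSpinor p w ≠ 0) (k : ℕ) :
    hopf (dataSpinor (layerStrip^[k] p) w) =
      precession w (pulseRotation (pulseOfParam (schurParam (layerStrip^[k] p)))
        (hopf (dataSpinor (layerStrip^[k + 1] p) w))) := by
  have hw : ‖(w : ℂ)‖ ≤ 1 := (Circle.norm_coe w).le
  rw [precession_pulseRotation_hopf w (norm_pulseOfParam_lt_pi _)
      (h.dataSpinor_iterate_layerStrip_ne_zero hw w.coe_ne_zero h0 _),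
    pulseParam_pulseOfParam, Function.iterate_succ_apply',
    (h.iterate_layerStrip k).spinorStep_dataSpinor_layerStrip hw,
    hopf_smul (one_add_conj_mul_self_ne_zero _)]

theorem isRephasedPulse (h : IsMarchenkoSolution κ p)
    (hκ : Summable fun k => (∑' n, ‖κ (n + k)‖) ^ 3) {r₀ : Circle → ℂ}
    (hr₀ : ∀ w : Circle, (dataSpinor p w).1 ≠ 0 ∧ (dataSpinor p w).2 = (dataSpinor p w).1 * r₀ w)
    {ρ : ℤ} {M : Circle → Fin 3 → ℝ} (hM : ∀ w, M w = hopf (1, (w : ℂ) ^ (-ρ) * r₀ w)) :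
    IsRephasedPulse ρ M (pulseOfParams ρ fun k => schurParam (layerStrip^[k] p)) := by
  refine isRephasedPulse_pulseOfParams (h.summable_schurParam hκ)
    (S := fun w k => hopf (dataSpinor (layerStrip^[k] p) w))
    (fun w k => h.hopf_dataSpinor_iterate_layerStrip (fun h0 => (hr₀ w).1 (by rw [h0]; rfl)) k)
    (fun w => h.tendsto_hopf_dataSpinor (Circle.norm_coe w).le) fun w => ?_
  rw [Function.iterate_zero, id, hopf_eq_hopf_one_div (hr₀ w).1, precession_hopf, hM w,
    (hr₀ w).2, mul_div_cancel_left₀ _ (hr₀ w).1, Circle.coe_zpow]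

end IsMarchenkoSolution

/-! ### Fourier coefficients and the Sobolev class `H¹` on the circle -/

section FourierCoeff

variable {T : ℝ} [Fact (0 < T)]

theorem integrable_haarAddCircle {E : Type*} [NormedAddCommGroup E] {f : AddCircle T → E}
    (hf : Continuous f) : Integrable f AddCircle.haarAddCircle :=
  hf.integrable_of_hasCompactSupport (.of_compactSpace f)

theorem fourierCoeff_conj (f : AddCircle T → ℂ) (n : ℤ) :
    fourierCoeff (fun x => conj (f x)) n = conj (fourierCoeff f (-n)) := by
  simp only [fourierCoeff, ← integral_conj, smul_eq_mul, map_mul, ← fourier_neg, neg_neg]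

theorem fourierCoeff_comp_add_right (f : AddCircle T → ℂ) (h : AddCircle T) (n : ℤ) :
    fourierCoeff (fun x => f (x + h)) n = fourier n h * fourierCoeff f n := by
  rw [fourierCoeff, fourierCoeff, ← integral_const_mul,
    ← integral_add_right_eq_self (fun x => fourier n h * fourier (-n) x • f x) h]
  refine integral_congr_ae (.of_forall fun x => ?_)
  have hadd : fourier (-n) (x + h) = fourier (-n) x * fourier (-n) h := by
    simp only [fourier_apply, smul_add, AddCircle.toCircle_add, Circle.coe_mul]
  have hcancel : fourier n h * fourier (-n) (x + h) = fourier (-n) x := by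
    rw [hadd, mul_left_comm, ← fourier_add, add_neg_cancel, fourier_zero, mul_one]
  simp only [smul_eq_mul, ← mul_assoc, hcancel]

/-- The `n`-th Fourier coefficient as a continuous linear functional on continuous functions. -/
noncomputable def fourierCoeffCLM (n : ℤ) : C(AddCircle T, ℂ) →L[ℂ] ℂ :=
  (innerSL ℂ (fourierBasis n)).comp (ContinuousMap.toLp 2 AddCircle.haarAddCircle ℂ)

theorem fourierCoeffCLM_apply (n : ℤ) (f : C(AddCircle T, ℂ)) :
    fourierCoeffCLM n f = fourierCoeff f n := by
  rw [← fourierCoeff_toLp, ← fourierBasis_repr, HilbertBasis.repr_apply_apply]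
  rfl

theorem hasSum_sq_fourierCoeff_of_continuous {f : AddCircle T → ℂ} (hf : Continuous f) :
    HasSum (fun n => ‖fourierCoeff f n‖ ^ 2) (∫ x, ‖f x‖ ^ 2 ∂AddCircle.haarAddCircle) := by
  let F : C(AddCircle T, ℂ) := ⟨f, hf⟩
  have hnorm : ∫ x, ‖f x‖ ^ 2 ∂AddCircle.haarAddCircle =
      ∫ x, ‖F.toLp (E := ℂ) 2 AddCircle.haarAddCircle ℂ x‖ ^ 2 ∂AddCircle.haarAddCircle := by
    refine integral_congr_ae ?_
    filter_upwards [ContinuousMap.coeFn_toLp (p := 2) (E := ℂ) (𝕜 := ℂ)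
      (AddCircle.haarAddCircle (T := T)) F] with x hx
    rw [hx, ContinuousMap.coe_mk]
  have hparseval := hasSum_sq_fourierCoeff (F.toLp (E := ℂ) 2 AddCircle.haarAddCircle ℂ)
  simp only [fourierCoeff_toLp] at hparseval
  rwa [hnorm]

theorem hasSum_fourierCoeff_mul {f g : AddCircle T → ℂ} (hf : Continuous f) (hg : Continuous g)
    (hsum : Summable (fourierCoeff f)) (n : ℤ) :
    HasSum (fun k => fourierCoeff f k * fourierCoeff g (n - k))
      (fourierCoeff (fun x => f x * g x) n) := by
  have hseries : HasSum (fun k => fourierCoeff f k • fourier k * ⟨g, hg⟩) (⟨f, hf⟩ * ⟨g, hg⟩) :=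
    (hasSum_fourier_series_of_summable (f := ⟨f, hf⟩) hsum).mul_right _
  convert hseries.mapL (fourierCoeffCLM n) using 1
  · funext k
    rw [smul_mul_assoc, map_smul, fourierCoeffCLM_apply, smul_eq_mul]
    congr 1
    refine integral_congr_ae (.of_forall fun x => ?_)
    simp only [smul_eq_mul, ContinuousMap.coe_mul, Pi.mul_apply, ContinuousMap.coe_mk,
      ← mul_assoc, ← fourier_add]
    rw [neg_sub, sub_eq_neg_add]
  · rw [fourierCoeffCLM_apply]
    rfl

theorem fourierCoeff_tsum_smul_fourier {c : ℤ → ℂ} (hc : Summable fun n => ‖c n‖) (m : ℤ) :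
    fourierCoeff (∑' n, c n • fourier n : C(AddCircle T, ℂ)) m = c m := by
  have hsum : Summable fun n => c n • (fourier n : C(AddCircle T, ℂ)) :=
    .of_norm (by simpa only [norm_smul, fourier_norm, mul_one] using hc)
  rw [← fourierCoeffCLM_apply, (fourierCoeffCLM m).map_tsum hsum, tsum_eq_single m]
  · rw [map_smul, fourierCoeffCLM_apply, fourierCoeff_fourier, Pi.single_eq_same, smul_eq_mul,
      mul_one]
  · intro n hn
    rw [map_smul, fourierCoeffCLM_apply, fourierCoeff_fourier, Pi.single_eq_of_ne hn.symm,
      smul_zero]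

end FourierCoeff

instance fact_two_pi_pos : Fact (0 < 2 * Real.pi) := ⟨Real.two_pi_pos⟩

/-- The circle of length `2π`, on which Fourier coefficients are computed. -/
abbrev AngleCircle : Type := AddCircle (2 * Real.pi)

/-- The point `exp (i x)` of the unit circle in `ℂ`. -/
noncomputable abbrev unitPoint (x : AngleCircle) : ℂ := (AddCircle.toCircle x : ℂ)

theorem toCircle_surjective : Function.Surjective (AddCircle.toCircle (T := 2 * Real.pi)) :=
  fun w => ⟨(Complex.arg w : ℝ), by
    rw [AddCircle.toCircle_apply_mk, div_self Real.two_pi_pos.ne', one_mul, Circle.exp_arg]⟩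

theorem fourier_eq_unitPoint_zpow (n : ℤ) (x : AngleCircle) : fourier n x = unitPoint x ^ n := by
  rw [fourier_apply, AddCircle.toCircle_zsmul, Circle.coe_zpow]

theorem unitPoint_coe (θ : ℝ) : unitPoint (θ : AngleCircle) = circleMap 0 1 θ := by
  rw [unitPoint, AddCircle.toCircle_apply_mk, Circle.coe_exp, circleMap,
    div_self Real.two_pi_pos.ne', one_mul, Complex.ofReal_one, one_mul, zero_add]

theorem norm_fourier_coe_sub_one_le (n : ℤ) (h : ℝ) :
    ‖fourier n (h : AngleCircle) - 1‖ ≤ |n * h| := by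
  have hexp : fourier n (h : AngleCircle) = Complex.exp (Complex.I * ((n * h : ℝ) : ℂ)) := by
    rw [fourier_eq_unitPoint_zpow, unitPoint_coe, circleMap_zero, Complex.ofReal_one, one_mul,
      ← Complex.exp_int_mul]
    push_cast
    ring_nf
  rw [hexp]
  exact Real.norm_exp_I_mul_ofReal_sub_one_le

theorem tendsto_norm_slope_fourier_zero (n : ℤ) :
    Tendsto (fun h : ℝ => ‖h⁻¹ • (fourier n (h : AngleCircle) - 1)‖) (𝓝[≠] 0) (𝓝 |(n : ℝ)|) := by
  have hslope := (hasDerivAt_fourier (2 * Real.pi) n 0).tendsto_slope_zero.norm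
  simp only [zero_add, QuotientAddGroup.mk_zero, fourier_eval_zero, mul_one] at hslope
  convert hslope using 2
  simp [abs_of_pos Real.pi_pos, Real.pi_ne_zero]

/-- The Sobolev class `H¹` of the circle, characterized among continuous functions by a bound on
the mean square difference quotients. -/
structure IsSobolevCircle {E : Type*} [NormedAddCommGroup E] (f : AngleCircle → E) : Prop where
  continuous : Continuous f
  bound : ∃ C : ℝ, ∀ h : ℝ,
    ∫ x, ‖f (x + (h : AngleCircle)) - f x‖ ^ 2 ∂AddCircle.haarAddCircle ≤ C * h ^ 2

theorem hasSum_sq_norm_fourier_sub_one_mul {f : AngleCircle → ℂ} (hf : Continuous f)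
    (h : AngleCircle) :
    HasSum (fun n => ‖fourier n h - 1‖ ^ 2 * ‖fourierCoeff f n‖ ^ 2)
      (∫ x, ‖f (x + h) - f x‖ ^ 2 ∂AddCircle.haarAddCircle) := by
  have htranslate : Continuous fun x => f (x + h) := hf.comp (continuous_add_const h)
  convert hasSum_sq_fourierCoeff_of_continuous (f := fun x => f (x + h) - f x)
    (htranslate.sub hf) using 2 with n
  have hcoeff := map_sub (fourierCoeffCLM n) (⟨_, htranslate⟩ : C(AngleCircle, ℂ)) ⟨f, hf⟩
  simp only [fourierCoeffCLM_apply, ContinuousMap.coe_sub, ContinuousMap.coe_mk,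
    Pi.sub_def] at hcoeff
  rw [hcoeff, fourierCoeff_comp_add_right, ← sub_one_mul, norm_mul, mul_pow]

theorem isSobolevCircle_of_summable {f : AngleCircle → ℂ} (hf : Continuous f)
    (hs : Summable fun n : ℤ => (n * ‖fourierCoeff f n‖) ^ 2) : IsSobolevCircle f := by
  refine ⟨hf, ∑' n : ℤ, (n * ‖fourierCoeff f n‖) ^ 2, fun h => ?_⟩
  rw [← tsum_mul_right]
  refine hasSum_le (fun n => ?_) (hasSum_sq_norm_fourier_sub_one_mul hf h) (hs.mul_right _).hasSum
  calc ‖fourier n (h : AngleCircle) - 1‖ ^ 2 * ‖fourierCoeff f n‖ ^ 2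
      ≤ |n * h| ^ 2 * ‖fourierCoeff f n‖ ^ 2 := by
        gcongr
        exact norm_fourier_coe_sub_one_le n h
    _ = (n * ‖fourierCoeff f n‖) ^ 2 * h ^ 2 := by rw [sq_abs]; ring

theorem isSobolevCircle_tsum_smul_fourier {c : ℤ → ℂ} (hc : Summable fun n => ‖c n‖)
    (hw : Summable fun n : ℤ => (n * ‖c n‖) ^ 2) :
    IsSobolevCircle (∑' n, c n • fourier n : C(AngleCircle, ℂ)) :=
  isSobolevCircle_of_summable (ContinuousMap.continuous _)
    (by simpa only [fourierCoeff_tsum_smul_fourier hc] using hw)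

namespace IsSobolevCircle

section FourierSeries

variable {f : AngleCircle → ℂ}

theorem summable_sq_mul_norm_fourierCoeff (hf : IsSobolevCircle f) :
    Summable fun n : ℤ => (n * ‖fourierCoeff f n‖) ^ 2 := by
  obtain ⟨C, hC⟩ := hf.bound
  refine summable_of_sum_le (c := C) (fun n => sq_nonneg _) fun s => ?_
  have hlim : Tendsto (fun h : ℝ =>
      ∑ n ∈ s, (‖h⁻¹ • (fourier n (h : AngleCircle) - 1)‖ * ‖fourierCoeff f n‖) ^ 2)
      (𝓝[≠] 0) (𝓝 (∑ n ∈ s, (|(n : ℝ)| * ‖fourierCoeff f n‖) ^ 2)) :=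
    tendsto_finsetSum s fun n _ => ((tendsto_norm_slope_fourier_zero n).mul_const _).pow 2
  simp only [mul_pow, sq_abs] at hlim
  simp only [mul_pow]
  refine le_of_tendsto hlim ?_
  filter_upwards [self_mem_nhdsWithin] with h (hh : h ≠ 0)
  have hpartial := (sum_le_hasSum s (fun n _ => by positivity)
    (hasSum_sq_norm_fourier_sub_one_mul hf.continuous h)).trans (hC h)
  simp only [norm_smul, norm_inv, Real.norm_eq_abs, mul_pow, inv_pow, sq_abs, mul_assoc]
  rwa [← Finset.mul_sum, inv_mul_le_iff₀ (by positivity), mul_comm (h ^ 2)]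

theorem summable_norm_fourierCoeff (hf : IsSobolevCircle f) :
    Summable fun n => ‖fourierCoeff f n‖ := by
  have hinv : Summable fun n : ℤ => ((n : ℝ) ^ 2)⁻¹ := by
    simpa only [one_div] using Real.summable_one_div_int_pow.2 one_lt_two
  refine (hinv.add hf.summable_sq_mul_norm_fourierCoeff).of_norm_bounded_eventually ?_
  filter_upwards [(Set.finite_singleton (0 : ℤ)).compl_mem_cofinite] with n hn
  have hn : (n : ℝ) ≠ 0 := Int.cast_ne_zero.2 hn
  have hsplit : ‖fourierCoeff f n‖ = |(n : ℝ)⁻¹| * |n * ‖fourierCoeff f n‖| := by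
    rw [← abs_mul, inv_mul_cancel_left₀ hn, abs_norm]
  calc ‖‖fourierCoeff f n‖‖ = |(n : ℝ)⁻¹| * |n * ‖fourierCoeff f n‖| := by
        rw [norm_norm, ← hsplit]
    _ ≤ |(n : ℝ)⁻¹| ^ 2 + |n * ‖fourierCoeff f n‖| ^ 2 := by
        nlinarith [two_mul_le_add_sq |(n : ℝ)⁻¹| |n * ‖fourierCoeff f n‖|,
          mul_nonneg (abs_nonneg (n : ℝ)⁻¹) (abs_nonneg (n * ‖fourierCoeff f n‖))]
    _ = ((n : ℝ) ^ 2)⁻¹ + (n * ‖fourierCoeff f n‖) ^ 2 := by rw [sq_abs, sq_abs, inv_pow]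

theorem hasSum_fourier (hf : IsSobolevCircle f) (x : AngleCircle) :
    HasSum (fun n => fourierCoeff f n * unitPoint x ^ n) (f x) := by
  simpa only [smul_eq_mul, fourier_eq_unitPoint_zpow, ContinuousMap.coe_mk] using
    has_pointwise_sum_fourier_series_of_summable (f := ⟨f, hf.continuous⟩)
      hf.summable_norm_fourierCoeff.of_norm x

end FourierSeries

section Composition

variable {E F : Type*} [NormedAddCommGroup E] [NormedAddCommGroup F]
  {f : AngleCircle → E} {g : AngleCircle → F}

theorem const (c : E) : IsSobolevCircle fun _ => c :=
  ⟨continuous_const, 0, fun h => by simp⟩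

theorem integrable_sq_norm_sub (hf : IsSobolevCircle f) (h : AngleCircle) :
    Integrable (fun x => ‖f (x + h) - f x‖ ^ 2) AddCircle.haarAddCircle :=
  integrable_haarAddCircle
    (((hf.continuous.comp (continuous_add_const h)).sub hf.continuous).norm.pow 2)

theorem prodMk (hf : IsSobolevCircle f) (hg : IsSobolevCircle g) :
    IsSobolevCircle fun x => (f x, g x) := by
  obtain ⟨C, hC⟩ := hf.bound
  obtain ⟨D, hD⟩ := hg.bound
  refine ⟨hf.continuous.prodMk hg.continuous, C + D, fun h => ?_⟩
  have hint := (hf.integrable_sq_norm_sub h).add (hg.integrable_sq_norm_sub h)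
  calc ∫ x : AngleCircle, ‖(f (x + h), g (x + h)) - (f x, g x)‖ ^ 2 ∂AddCircle.haarAddCircle
      ≤ ∫ x : AngleCircle, (‖f (x + h) - f x‖ ^ 2 + ‖g (x + h) - g x‖ ^ 2)
          ∂AddCircle.haarAddCircle := by
        refine integral_mono_of_nonneg (.of_forall fun x => sq_nonneg _) hint
          (.of_forall fun x => ?_)
        simp only [Prod.mk_sub_mk, Prod.norm_mk]
        rcases max_cases ‖f (x + h) - f x‖ ‖g (x + h) - g x‖ with ⟨hmax, -⟩ | ⟨hmax, -⟩ <;>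
          rw [hmax] <;> nlinarith [sq_nonneg ‖f (x + h) - f x‖, sq_nonneg ‖g (x + h) - g x‖]
    _ ≤ C * h ^ 2 + D * h ^ 2 := by
        rw [integral_add (hf.integrable_sq_norm_sub h) (hg.integrable_sq_norm_sub h)]
        exact add_le_add (hC h) (hD h)
    _ = (C + D) * h ^ 2 := by ring

theorem comp_lipschitzOnWith (hf : IsSobolevCircle f) {φ : E → F} {K : NNReal}
    (hφ : LipschitzOnWith K φ (Set.range f)) : IsSobolevCircle fun x => φ (f x) := by
  obtain ⟨C, hC⟩ := hf.bound
  refine ⟨hφ.continuousOn.comp_continuous hf.continuous Set.mem_range_self, K ^ 2 * C,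
    fun h => ?_⟩
  calc ∫ x : AngleCircle, ‖φ (f (x + h)) - φ (f x)‖ ^ 2 ∂AddCircle.haarAddCircle
      ≤ ∫ x : AngleCircle, K ^ 2 * ‖f (x + h) - f x‖ ^ 2 ∂AddCircle.haarAddCircle := by
        refine integral_mono_of_nonneg (.of_forall fun x => sq_nonneg _)
          ((hf.integrable_sq_norm_sub h).const_mul _) (.of_forall fun x => ?_)
        simp only [← mul_pow]
        gcongr
        exact hφ.norm_sub_le (Set.mem_range_self _) (Set.mem_range_self _)
    _ ≤ K ^ 2 * (C * h ^ 2) := by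
        rw [integral_const_mul]
        gcongr
        exact hC h
    _ = K ^ 2 * C * h ^ 2 := by ring

theorem comp_contDiffAt [NormedSpace ℝ E] [NormedSpace ℝ F] (hf : IsSobolevCircle f) {φ : E → F}
    (hφ : ∀ x, ContDiffAt ℝ 1 φ (f x)) : IsSobolevCircle fun x => φ (f x) := by
  have hloc : LocallyLipschitzOn (Set.range f) φ := by
    rintro _ ⟨x, rfl⟩
    obtain ⟨K, t, ht, hK⟩ := (hφ x).exists_lipschitzOnWith
    exact ⟨K, t, mem_nhdsWithin_of_mem_nhds ht, hK⟩
  obtain ⟨K, hK⟩ := hloc.exists_lipschitzOnWith_of_compact (isCompact_range hf.continuous)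
  exact hf.comp_lipschitzOnWith hK

end Composition

variable {f g : AngleCircle → ℂ}

theorem add (hf : IsSobolevCircle f) (hg : IsSobolevCircle g) :
    IsSobolevCircle fun x => f x + g x :=
  (hf.prodMk hg).comp_contDiffAt (φ := fun p => p.1 + p.2) fun _ => by fun_prop

theorem sub (hf : IsSobolevCircle f) (hg : IsSobolevCircle g) :
    IsSobolevCircle fun x => f x - g x :=
  (hf.prodMk hg).comp_contDiffAt (φ := fun p => p.1 - p.2) fun _ => by fun_prop

theorem mul (hf : IsSobolevCircle f) (hg : IsSobolevCircle g) :
    IsSobolevCircle fun x => f x * g x :=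
  (hf.prodMk hg).comp_contDiffAt (φ := fun p => p.1 * p.2) fun _ => by fun_prop

theorem inv (hf : IsSobolevCircle f) (h0 : ∀ x, f x ≠ 0) : IsSobolevCircle fun x => (f x)⁻¹ :=
  hf.comp_contDiffAt (φ := fun z => z⁻¹) fun x => contDiffAt_inv ℝ (h0 x)

theorem star (hf : IsSobolevCircle f) : IsSobolevCircle fun x => starRingEnd ℂ (f x) :=
  hf.comp_contDiffAt (φ := starRingEnd ℂ) fun _ => Complex.conjCLE.contDiff.contDiffAt

theorem exp (hf : IsSobolevCircle f) : IsSobolevCircle fun x => Complex.exp (f x) :=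
  hf.comp_contDiffAt fun _ => Complex.contDiff_exp.contDiffAt

end IsSobolevCircle

theorem isSobolevCircle_unitPoint_zpow (n : ℤ) : IsSobolevCircle fun x => unitPoint x ^ n := by
  simp only [← fourier_eq_unitPoint_zpow]
  refine isSobolevCircle_of_summable (fourier n).continuous ?_
  rw [fourierCoeff_fourier]
  refine summable_of_ne_finset_zero (s := {n}) fun m hm => ?_
  rw [Pi.single_eq_of_ne (Finset.notMem_singleton.1 hm), norm_zero, mul_zero, zero_pow two_ne_zero]

theorem fourierCoeff_angleCircle (f : AngleCircle → ℂ) (n : ℤ) :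
    fourierCoeff f n = (2 * Real.pi)⁻¹ •
      ∫ θ in (0 : ℝ)..(2 * Real.pi), f θ * fourier (-n) (θ : AngleCircle) := by
  rw [fourierCoeff_eq_intervalIntegral f n 0, zero_add, one_div]
  congr 1
  exact intervalIntegral.integral_congr fun θ _ => mul_comm _ _

theorem fourierCoeffOn_angleCircle (f : AngleCircle → ℂ) (n : ℤ) :
    fourierCoeffOn Real.two_pi_pos (fun θ : ℝ => f θ) n = fourierCoeff f n := by
  rw [fourierCoeffOn_eq_integral, fourierCoeff_eq_intervalIntegral f n 0]
  simp only [fourier_coe_apply, sub_zero, zero_add]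

/-- The weak derivative of `f` has the Fourier coefficients `i n f̂(n)`. -/
theorem MemSobolevH1.summable_sq_mul_norm_fourierCoeff {f : Circle → ℂ} (hf : MemSobolevH1 f) :
    Summable fun n : ℤ =>
      (n * ‖fourierCoeff (fun x : AngleCircle => f (AddCircle.toCircle x)) n‖) ^ 2 := by
  have hexp (θ : ℝ) : AddCircle.toCircle (θ : AngleCircle) = Circle.exp θ := by
    rw [AddCircle.toCircle_apply_mk, div_self Real.two_pi_pos.ne', one_mul]
  obtain ⟨-, g, hg, hfg⟩ := hf
  have hcoeff (n : ℤ) : fourierCoeff (fun x : AngleCircle => g (AddCircle.toCircle x)) n =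
      n * Complex.I * fourierCoeff (fun x : AngleCircle => f (AddCircle.toCircle x)) n := by
    have hderiv (θ : ℝ) : HasDerivAt (fun t : ℝ => fourier (-n) (t : AngleCircle))
        (-(n * Complex.I) * fourier (-n) (θ : AngleCircle)) θ := by
      convert hasDerivAt_fourier_neg (2 * Real.pi) n θ using 2
      push_cast
      field_simp
    have hsmooth : ContDiff ℝ (⊤ : ℕ∞) fun t : ℝ => fourier (-n) (t : AngleCircle) := by
      simp only [fourier_coe_apply]
      exact ((contDiff_const.mul Complex.ofRealCLM.contDiff).div_const _).cexp
    have hweak := hfg _ hsmooth fun θ => by rw [AddCircle.coe_add_period]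
    simp only [(hderiv _).deriv, mul_left_comm _ (-(n * Complex.I)),
      intervalIntegral.integral_const_mul] at hweak
    simp only [fourierCoeff_angleCircle, hexp, mul_smul_comm]
    congr 1
    linear_combination hweak
  refine (hasSum_sq_fourierCoeffOn Real.two_pi_pos hg).summable.congr fun n => ?_
  simp only [← hexp]
  rw [fourierCoeffOn_angleCircle fun x => g (AddCircle.toCircle x), hcoeff, norm_mul, norm_mul,
    Complex.norm_I, mul_one, mul_pow, mul_pow, Complex.norm_intCast, sq_abs]

theorem MemSobolevH1.isSobolevCircle {f : Circle → ℂ} (hf : MemSobolevH1 f) (hc : Continuous f) :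
    IsSobolevCircle fun x => f (AddCircle.toCircle x) :=
  isSobolevCircle_of_summable (hc.comp AddCircle.continuous_toCircle)
    hf.summable_sq_mul_norm_fourierCoeff

/-! ### The disk algebra -/

section DiskAlgebra

variable {f : ℂ → ℂ}

theorem norm_unitPoint (x : AngleCircle) : ‖unitPoint x‖ = 1 := Circle.norm_coe _

theorem coe_circle_mem_closure_ball (w : Circle) : (w : ℂ) ∈ closure (Metric.ball (0 : ℂ) 1) := by
  rw [closure_ball _ one_ne_zero, mem_closedBall_zero_iff, Circle.norm_coe]

theorem fourierCoeff_neg_natCast_of_diffContOnCl (hf : DiffContOnCl ℂ f (Metric.ball 0 1))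
    (n : ℕ) : fourierCoeff (fun x => f (unitPoint x)) (-n) = 0 ^ n * f 0 := by
  have hmul : DiffContOnCl ℂ (fun z => z ^ n * f z) (Metric.ball 0 1) :=
    (differentiable_id.pow n).diffContOnCl.smul hf
  rw [← DiffContOnCl.circleAverage (f := fun z => z ^ n * f z) (by rwa [abs_one]),
    fourierCoeff_eq_intervalIntegral _ _ 0, zero_add, Real.circleAverage_def, one_div]
  congr 1
  refine intervalIntegral.integral_congr fun θ _ => ?_
  simp only [neg_neg, smul_eq_mul, fourier_eq_unitPoint_zpow, unitPoint_coe, zpow_natCast]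

theorem fourierCoeff_zero_of_diffContOnCl (hf : DiffContOnCl ℂ f (Metric.ball 0 1)) :
    fourierCoeff (fun x => f (unitPoint x)) 0 = f 0 := by
  simpa using fourierCoeff_neg_natCast_of_diffContOnCl hf 0

theorem fourierCoeff_eq_zero_of_neg (hf : DiffContOnCl ℂ f (Metric.ball 0 1)) {m : ℤ}
    (hm : m < 0) : fourierCoeff (fun x => f (unitPoint x)) m = 0 := by
  obtain ⟨n, hn⟩ := Int.eq_ofNat_of_zero_le (neg_nonneg.2 hm.le)
  obtain rfl := neg_eq_iff_eq_neg.1 hn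
  rw [fourierCoeff_neg_natCast_of_diffContOnCl hf, zero_pow (by lia), zero_mul]

theorem diffContOnCl_powerSum {a : ℕ → ℂ} (ha : Summable fun n => ‖a n‖) :
    DiffContOnCl ℂ (powerSum a) (Metric.ball 0 1) := by
  have hle (n : ℕ) (z : ℂ) (hz : z ∈ Metric.closedBall (0 : ℂ) 1) : ‖a n * z ^ n‖ ≤ ‖a n‖ := by
    rw [norm_mul, norm_pow]
    exact mul_le_of_le_one_right (norm_nonneg _)
      (pow_le_one₀ (norm_nonneg _) (mem_closedBall_zero_iff.1 hz))
  refine ⟨Complex.differentiableOn_tsum_of_summable_norm ha (fun n => by fun_prop)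
    Metric.isOpen_ball fun n z hz => hle n z (Metric.ball_subset_closedBall hz), ?_⟩
  rw [closure_ball (0 : ℂ) one_ne_zero]
  exact continuousOn_tsum (fun n => by fun_prop) ha hle

theorem isSobolevCircle_powerSum {a : ℕ → ℂ} (ha : Summable fun n => ‖a n‖)
    (hw : Summable fun n : ℕ => (n * ‖a n‖) ^ 2) :
    IsSobolevCircle fun x => powerSum a (unitPoint x) := by
  let c : ℤ → ℂ := Function.extend Nat.cast a 0
  have hc (n : ℕ) : c n = a n := Nat.cast_injective.extend_apply a 0 n
  have hc' {m : ℤ} (hm : m ∉ Set.range (Nat.cast : ℕ → ℤ)) : c m = 0 :=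
    Function.extend_apply' _ _ _ hm
  have hcsum : Summable fun m => ‖c m‖ := by
    rw [← Nat.cast_injective.summable_iff fun m hm => by rw [hc' hm, norm_zero]]
    simpa only [Function.comp_def, hc] using ha
  have hcw : Summable fun m : ℤ => (m * ‖c m‖) ^ 2 := by
    rw [← Nat.cast_injective.summable_iff fun m hm => by simp only [hc' hm, norm_zero, mul_zero,
      ne_eq, OfNat.ofNat_ne_zero, not_false_eq_true, zero_pow]]
    simpa only [Function.comp_def, hc, Int.cast_natCast] using hw
  convert isSobolevCircle_tsum_smul_fourier hcsum hcw using 2 with x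
  have hfourier : Summable fun m => c m • (fourier m : C(AngleCircle, ℂ)) :=
    .of_norm (by simpa only [norm_smul, fourier_norm, mul_one] using hcsum)
  rw [← ContinuousMap.tsum_apply hfourier, powerSum,
    ← (Nat.cast_injective (R := ℤ)).tsum_eq fun m hm => ?_]
  · simp only [ContinuousMap.smul_apply, hc, fourier_eq_unitPoint_zpow, zpow_natCast, smul_eq_mul]
  · by_contra hrange
    exact hm (by simp only [hc' hrange, zero_smul, ContinuousMap.zero_apply])

end DiskAlgebra

/-- The functions holomorphic in the open unit disk, continuous up to the boundary, and with
boundary values in `H¹`. Values outside the closed disk are unrestricted. -/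
noncomputable def sobolevDiskAlgebra : Subalgebra ℂ (ℂ → ℂ) where
  carrier := {f | DiffContOnCl ℂ f (Metric.ball 0 1) ∧ IsSobolevCircle fun x => f (unitPoint x)}
  mul_mem' hf hg := ⟨hf.1.smul hg.1, hf.2.mul hg.2⟩
  add_mem' hf hg := ⟨hf.1.add hg.1, hf.2.add hg.2⟩
  algebraMap_mem' c := ⟨diffContOnCl_const, .const c⟩

namespace sobolevDiskAlgebra

theorem diffContOnCl (f : sobolevDiskAlgebra) : DiffContOnCl ℂ f.1 (Metric.ball 0 1) := f.2.1

theorem isSobolevCircle (f : sobolevDiskAlgebra) : IsSobolevCircle fun x => f.1 (unitPoint x) :=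
  f.2.2

theorem eq_powerSum (f : sobolevDiskAlgebra) (x : AngleCircle) :
    f.1 (unitPoint x) =
      powerSum (fun n : ℕ => fourierCoeff (fun y => f.1 (unitPoint y)) n) (unitPoint x) := by
  have hsum := (isSobolevCircle f).hasSum_fourier x
  rw [← (Nat.cast_injective (R := ℤ)).hasSum_iff fun m hm => ?_] at hsum
  · simpa only [powerSum, Function.comp_apply, zpow_natCast] using hsum.tsum_eq.symm
  · rw [fourierCoeff_eq_zero_of_neg (diffContOnCl f), zero_mul]
    exact not_le.1 fun h0 => hm ⟨m.toNat, Int.toNat_of_nonneg h0⟩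

theorem summable_norm_fourierCoeff_natCast (f : sobolevDiskAlgebra) :
    Summable fun n : ℕ => ‖fourierCoeff (fun y => f.1 (unitPoint y)) n‖ :=
  ((isSobolevCircle f).summable_norm_fourierCoeff.comp_injective Nat.cast_injective :)

theorem eq_mul_powerSum (f : sobolevDiskAlgebra) (h0 : f.1 0 = 0) (x : AngleCircle) :
    f.1 (unitPoint x) = unitPoint x *
      powerSum (fun n : ℕ => fourierCoeff (fun y => f.1 (unitPoint y)) (n + 1)) (unitPoint x) := by
  rw [eq_powerSum, powerSum_eq_add_mul_powerSum_succ (summable_norm_fourierCoeff_natCast f)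
    (norm_unitPoint x).le, Nat.cast_zero, fourierCoeff_zero_of_diffContOnCl (diffContOnCl f), h0,
    zero_add]
  simp only [Nat.cast_succ]

/-- The coordinate function `z ↦ z`. -/
noncomputable def coord : sobolevDiskAlgebra :=
  ⟨id, differentiable_id.diffContOnCl, by simpa using isSobolevCircle_unitPoint_zpow 1⟩

theorem aeval_coord_apply (Q : Polynomial ℂ) (z : ℂ) :
    (Polynomial.aeval coord Q).1 z = Q.eval z := by
  induction Q using Polynomial.induction_on' with
  | add p q hp hq =>
    rw [map_add, Polynomial.eval_add, ← hp, ← hq]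
    rfl
  | monomial n c =>
    rw [Polynomial.aeval_monomial, Polynomial.eval_monomial]
    rfl

theorem powerSum_mem {a : ℕ → ℂ} (ha : Summable fun n => ‖a n‖)
    (hw : Summable fun n : ℕ => (n * ‖a n‖) ^ 2) : powerSum a ∈ sobolevDiskAlgebra :=
  ⟨diffContOnCl_powerSum ha, isSobolevCircle_powerSum ha hw⟩

theorem exp_mem {f : ℂ → ℂ} (hf : f ∈ sobolevDiskAlgebra) :
    (fun z => Complex.exp (f z)) ∈ sobolevDiskAlgebra :=
  ⟨Complex.differentiable_exp.comp_diffContOnCl hf.1, hf.2.exp⟩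

theorem isUnit_exp {f : ℂ → ℂ} (hf : f ∈ sobolevDiskAlgebra) :
    IsUnit (⟨fun z => Complex.exp (f z), exp_mem hf⟩ : sobolevDiskAlgebra) := by
  refine .of_mul_eq_one ⟨_, exp_mem (neg_mem hf)⟩ (Subtype.ext (funext fun z => ?_))
  change Complex.exp (f z) * Complex.exp (-f z) = 1
  rw [← Complex.exp_add, add_neg_cancel, Complex.exp_zero]

theorem dslope_mem {f : ℂ → ℂ} (hf : f ∈ sobolevDiskAlgebra) {a : ℂ}
    (ha : a ∈ Metric.ball (0 : ℂ) 1) : dslope f a ∈ sobolevDiskAlgebra := by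
  have hnhds : Metric.ball (0 : ℂ) 1 ∈ 𝓝 a := Metric.isOpen_ball.mem_nhds ha
  have hne (x : AngleCircle) : unitPoint x ≠ a := by
    rintro rfl
    exact (mem_ball_zero_iff.1 ha).ne (norm_unitPoint x)
  refine ⟨⟨(Complex.differentiableOn_dslope hnhds).2 hf.1.differentiableOn, ?_⟩, ?_⟩
  · rw [continuousOn_dslope (mem_of_superset hnhds subset_closure)]
    exact ⟨hf.1.continuousOn, hf.1.differentiableOn.differentiableAt hnhds⟩
  · simp only [dslope_of_ne f (hne _), slope_def_module, smul_eq_mul]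
    exact (((isSobolevCircle coord).sub (.const a)).inv fun x => sub_ne_zero.2 (hne x)).mul
      (hf.2.sub (.const _))

theorem isCoprime_coord_sub {f : sobolevDiskAlgebra} {a : ℂ} (ha : a ∈ Metric.ball (0 : ℂ) 1)
    (hfa : f.1 a ≠ 0) : IsCoprime f (coord - algebraMap ℂ sobolevDiskAlgebra a) := by
  refine ⟨algebraMap ℂ sobolevDiskAlgebra (f.1 a)⁻¹,
    -(algebraMap ℂ sobolevDiskAlgebra (f.1 a)⁻¹ * ⟨_, dslope_mem f.2 ha⟩),
    Subtype.ext (funext fun z => ?_)⟩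
  change (f.1 a)⁻¹ * f.1 z + -((f.1 a)⁻¹ * dslope f.1 a z) * (z - a) = 1
  have hslope : (z - a) * dslope f.1 a z = f.1 z - f.1 a := sub_smul_dslope f.1 a z
  linear_combination (-(f.1 a)⁻¹) * hslope + inv_mul_cancel₀ hfa

end sobolevDiskAlgebra

/-! ### Clearing the poles of a meromorphic extension -/

theorem tendsto_of_eventuallyEq_nhdsNE {X Y : Type*} [TopologicalSpace X] [TopologicalSpace Y]
    [RegularSpace Y] [∀ x : X, (𝓝[≠] x).NeBot] {U : Set X} (hU : IsOpen U) {G H : X → Y}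
    (hG : ContinuousOn G U) (hGH : ∀ z ∈ U, G =ᶠ[𝓝[≠] z] H) {x : X} {y : Y}
    (hH : Tendsto H (𝓝[U] x) (𝓝 y)) : Tendsto G (𝓝[U] x) (𝓝 y) := by
  rw [(closed_nhds_basis y).tendsto_right_iff]
  rintro V ⟨hV, hVclosed⟩
  have hHV : ∀ᶠ z in 𝓝[U] x, H z ∈ V := hH hV
  rw [eventually_nhdsWithin_iff, ← eventually_eventually_nhds] at hHV
  rw [eventually_nhdsWithin_iff]
  filter_upwards [hHV] with z hz hzU
  have hUz : U ∈ 𝓝 z := hU.mem_nhds hzU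
  have hGV : ∀ᶠ t in 𝓝[≠] z, G t ∈ V := by
    filter_upwards [hGH z hzU, nhdsWithin_le_nhds hz, nhdsWithin_le_nhds hUz] with t heq hV htU
    rw [heq]
    exact hV htU
  exact hVclosed.mem_of_tendsto ((hG.continuousAt hUz).mono_left nhdsWithin_le_nhds) hGV

theorem exists_diffContOnCl_eqOn_ball {G : ℂ → ℂ} {f : Circle → ℂ}
    (hG : DifferentiableOn ℂ G (Metric.ball 0 1))
    (hGf : ∀ w : Circle, Tendsto G (𝓝[Metric.ball 0 1] (w : ℂ)) (𝓝 (f w))) :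
    ∃ P : ℂ → ℂ, DiffContOnCl ℂ P (Metric.ball 0 1) ∧ Set.EqOn P G (Metric.ball 0 1) ∧
      ∀ w : Circle, P w = f w := by
  have heq : Set.EqOn (extendFrom (Metric.ball 0 1) G) G (Metric.ball 0 1) :=
    extendFrom_extends hG.continuousOn
  refine ⟨_, ⟨hG.congr heq, continuousOn_extendFrom subset_rfl fun z hz => ?_⟩, heq,
    fun w => extendFrom_eq (coe_circle_mem_closure_ball w) (hGf w)⟩
  rw [closure_ball _ one_ne_zero, mem_closedBall_zero_iff] at hz
  rcases hz.lt_or_eq with hlt | hone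
  · exact ⟨_, hG.continuousOn z (mem_ball_zero_iff.2 hlt)⟩
  · exact ⟨_, hGf ⟨z, mem_sphere_zero_iff_norm.2 hone⟩⟩

namespace IsMeromorphicExtension

variable {f : Circle → ℂ} {F : ℂ → ℂ}

theorem continuous (h : IsMeromorphicExtension f F) : Continuous f := by
  have hsphere : Metric.sphere (0 : ℂ) 1 ⊆ closure (Metric.ball (0 : ℂ) 1) :=
    fun z hz => coe_circle_mem_closure_ball ⟨z, hz⟩
  have hext : ContinuousOn (extendFrom (Metric.ball (0 : ℂ) 1) F) (Metric.sphere (0 : ℂ) 1) :=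
    continuousOn_extendFrom hsphere fun z hz => ⟨_, h.boundary ⟨z, hz⟩⟩
  have hf (w : Circle) : extendFrom (Metric.ball (0 : ℂ) 1) F w = f w :=
    extendFrom_eq (coe_circle_mem_closure_ball w) (h.boundary w)
  exact (hext.comp_continuous continuous_subtype_val fun w : Circle => w.2).congr hf

theorem eventually_notMem_diskPoles (h : IsMeromorphicExtension f F) (w : Circle) :
    ∀ᶠ z in 𝓝 (w : ℂ), z ∉ diskPoles F := by
  have hbound : ∀ᶠ z in 𝓝[Metric.ball 0 1] (w : ℂ), ‖F z‖ < ‖f w‖ + 1 :=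
    (h.boundary w).norm.eventually_lt_const (lt_add_one _)
  rw [eventually_nhdsWithin_iff, ← eventually_eventually_nhds] at hbound
  filter_upwards [hbound] with z hz hpole
  have hball : ∀ᶠ t in 𝓝 z, t ∈ Metric.ball (0 : ℂ) 1 := Metric.isOpen_ball.mem_nhds hpole.1
  have hlt : ∀ᶠ t in 𝓝[≠] z, ‖F t‖ < ‖f w‖ + 1 :=
    nhdsWithin_le_nhds ((hz.and hball).mono fun t ht => ht.1 ht.2)
  have htop : Tendsto (fun t => ‖F t‖) (𝓝[≠] z) atTop :=
    tendsto_norm_atTop_iff_cobounded.2 (tendsto_cobounded_of_meromorphicOrderAt_neg hpole.2)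
  obtain ⟨t, ht, ht'⟩ := (hlt.and (htop.eventually_ge_atTop (‖f w‖ + 1))).exists
  exact ht.not_ge ht'

theorem finite_diskPoles (h : IsMeromorphicExtension f F) : (diskPoles F).Finite := by
  by_contra hinf
  obtain ⟨z, hz, hacc⟩ := Set.Infinite.exists_accPt_of_subset_isCompact hinf
    (isCompact_closedBall (0 : ℂ) 1) fun z hz => Metric.ball_subset_closedBall hz.1
  rw [accPt_iff_frequently_nhdsNE] at hacc
  rcases (mem_closedBall_zero_iff.1 hz).lt_or_eq with hlt | hone
  · have hregular := (h.meromorphic z (mem_ball_zero_iff.2 hlt)).eventually_analyticAt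
    exact hacc (hregular.mono fun t ht hpole => hpole.2.not_ge ht.meromorphicOrderAt_nonneg)
  · exact hacc (nhdsWithin_le_nhds
      (h.eventually_notMem_diskPoles ⟨z, mem_sphere_zero_iff_norm.2 hone⟩))

end IsMeromorphicExtension

section PolePolynomial

variable {F : ℂ → ℂ}

/-- The monic polynomial whose zeros are the poles of `F`, with multiplicities. -/
noncomputable def polePoly (hfin : (diskPoles F).Finite) : Polynomial ℂ :=
  ∏ a ∈ hfin.toFinset, (Polynomial.X - Polynomial.C a) ^ poleMultiplicity F a

theorem eval_polePoly (hfin : (diskPoles F).Finite) (z : ℂ) :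
    (polePoly hfin).eval z = ∏ a ∈ hfin.toFinset, (z - a) ^ poleMultiplicity F a := by
  simp only [polePoly, Polynomial.eval_prod, Polynomial.eval_pow, Polynomial.eval_sub,
    Polynomial.eval_X, Polynomial.eval_C]

theorem eval_polePoly_ne_zero (hfin : (diskPoles F).Finite) {z : ℂ} (hz : z ∉ diskPoles F) :
    (polePoly hfin).eval z ≠ 0 := by
  rw [eval_polePoly, Finset.prod_ne_zero_iff]
  exact fun a ha => pow_ne_zero _ (sub_ne_zero.2 fun h => hz (h ▸ hfin.mem_toFinset.1 ha))

theorem coe_circle_notMem_diskPoles (w : Circle) : (w : ℂ) ∉ diskPoles F := fun h =>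
  (mem_ball_zero_iff.1 h.1).ne (Circle.norm_coe w)

theorem eval_polePoly_coe_circle_ne_zero (hfin : (diskPoles F).Finite) (w : Circle) :
    (polePoly hfin).eval (w : ℂ) ≠ 0 :=
  eval_polePoly_ne_zero hfin (coe_circle_notMem_diskPoles w)

theorem zero_notMem_diskPoles (hF : MeromorphicOn F (Metric.ball 0 1))
    (hF₀ : Tendsto F (𝓝[≠] 0) (𝓝 0)) : (0 : ℂ) ∉ diskPoles F := fun h =>
  h.2.not_ge ((tendsto_nhds_iff_meromorphicOrderAt_nonneg (hF 0 h.1)).1 ⟨0, hF₀⟩)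

theorem meromorphicOrderAt_eq_neg_poleMultiplicity {a : ℂ} (ha : a ∈ diskPoles F) :
    meromorphicOrderAt F a = ((-(poleMultiplicity F a : ℤ) : ℤ) : WithTop ℤ) := by
  obtain ⟨m, hm⟩ := WithTop.ne_top_iff_exists.1 ha.2.ne_top
  have hneg : m < 0 := by
    have := ha.2
    rw [← hm] at this
    exact_mod_cast this
  rw [poleMultiplicity, ← hm, WithTop.untop₀_coe, Int.toNat_of_nonneg (neg_nonneg.2 hneg.le),
    neg_neg]

theorem meromorphicOrderAt_polePoly_mul (hF : MeromorphicOn F (Metric.ball 0 1))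
    (hfin : (diskPoles F).Finite) {a : ℂ} (ha : a ∈ diskPoles F) :
    meromorphicOrderAt (fun z => (polePoly hfin).eval z * F z) a = 0 := by
  classical
  let G : ℂ → ℂ := fun z => ∏ b ∈ hfin.toFinset.erase a, (z - b) ^ poleMultiplicity F b
  have hGa : AnalyticAt ℂ G a :=
    Finset.analyticAt_fun_prod _ fun b _ => (analyticAt_id.sub analyticAt_const).pow _
  have hGa0 : G a ≠ 0 := Finset.prod_ne_zero_iff.2 fun b hb =>
    pow_ne_zero _ (sub_ne_zero.2 (Finset.ne_of_mem_erase hb).symm)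
  have hfactor : (fun z => (polePoly hfin).eval z * F z) =
      G * (((· - a) ^ poleMultiplicity F a : ℂ → ℂ) * F) := by
    funext z
    rw [eval_polePoly, ← Finset.mul_prod_erase _ _ (hfin.mem_toFinset.2 ha)]
    simp only [Pi.mul_apply, Pi.pow_apply, G]
    ring
  rw [hfactor, meromorphicOrderAt_mul_of_ne_zero hGa hGa0,
    meromorphicOrderAt_mul (by fun_prop) (hF a ha.1), meromorphicOrderAt_pow_id_sub_const,
    meromorphicOrderAt_eq_neg_poleMultiplicity ha]
  norm_cast
  exact add_neg_cancel _

theorem meromorphicOrderAt_polePoly_mul_nonneg (hF : MeromorphicOn F (Metric.ball 0 1))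
    (hfin : (diskPoles F).Finite) {z : ℂ} (hz : z ∈ Metric.ball (0 : ℂ) 1) :
    0 ≤ meromorphicOrderAt (fun z => (polePoly hfin).eval z * F z) z := by
  by_cases hpole : z ∈ diskPoles F
  · exact (meromorphicOrderAt_polePoly_mul hF hfin hpole).ge
  · have hQ : AnalyticAt ℂ (fun z => (polePoly hfin).eval z) z :=
      (polePoly hfin).differentiable.analyticAt z
    exact (not_lt.1 fun h => hpole ⟨hz, h⟩).trans_eq
      (meromorphicOrderAt_mul_of_ne_zero (f := F) hQ (eval_polePoly_ne_zero hfin hpole)).symm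

theorem isCoprime_aeval_polePoly (hfin : (diskPoles F).Finite) {f : sobolevDiskAlgebra}
    (hf : ∀ a ∈ diskPoles F, f.1 a ≠ 0) :
    IsCoprime f (Polynomial.aeval sobolevDiskAlgebra.coord (polePoly hfin)) := by
  simp only [polePoly, map_prod, map_pow, map_sub, Polynomial.aeval_X, Polynomial.aeval_C]
  refine .prod_right fun a ha => .pow_right ?_
  have ha := hfin.mem_toFinset.1 ha
  exact sobolevDiskAlgebra.isCoprime_coord_sub ha.1 (hf a ha)

end PolePolynomial

/-- The normal form of `Q F`, with `Q` the pole polynomial, is holomorphic in the disk and has the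
boundary values of `Q F`. -/
theorem IsMeromorphicExtension.exists_numerator {f : Circle → ℂ} {F : ℂ → ℂ}
    (h : IsMeromorphicExtension f F) (hF₀ : Tendsto F (𝓝[≠] 0) (𝓝 0))
    (hfin : (diskPoles F).Finite) :
    ∃ P : ℂ → ℂ, DiffContOnCl ℂ P (Metric.ball 0 1) ∧
      (∀ w : Circle, P w = (polePoly hfin).eval (w : ℂ) * f w) ∧ P 0 = 0 ∧
      ∀ a ∈ diskPoles F, P a ≠ 0 := by
  let Q := polePoly hfin
  let H : ℂ → ℂ := fun z => Q.eval z * F z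
  have hH : MeromorphicOn H (Metric.ball 0 1) := fun z hz =>
    (Q.differentiable.analyticAt z).meromorphicAt.mul (h.meromorphic z hz)
  let G := toMeromorphicNFOn H (Metric.ball 0 1)
  have hGH : ∀ z ∈ Metric.ball (0 : ℂ) 1, G =ᶠ[𝓝[≠] z] H := fun z hz =>
    hH.toMeromorphicNFOn_eq_self_on_nhdsNE hz
  have hGan : ∀ z ∈ Metric.ball (0 : ℂ) 1, AnalyticAt ℂ G z := fun z hz => by
    rw [← (meromorphicNFOn_toMeromorphicNFOn H _ hz).meromorphicOrderAt_nonneg_iff_analyticAt,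
      meromorphicOrderAt_toMeromorphicNFOn hH hz]
    exact meromorphicOrderAt_polePoly_mul_nonneg h.meromorphic hfin hz
  have hGdiff : DifferentiableOn ℂ G (Metric.ball 0 1) := fun z hz =>
    (hGan z hz).differentiableAt.differentiableWithinAt
  have hboundary (w : Circle) :
      Tendsto G (𝓝[Metric.ball 0 1] (w : ℂ)) (𝓝 (Q.eval (w : ℂ) * f w)) :=
    tendsto_of_eventuallyEq_nhdsNE Metric.isOpen_ball hGdiff.continuousOn hGH
      ((Q.continuous.continuousAt.mono_left nhdsWithin_le_nhds).mul (h.boundary w))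
  have hzero : (0 : ℂ) ∈ Metric.ball (0 : ℂ) 1 := Metric.mem_ball_self one_pos
  have hG0 : G 0 = 0 := by
    have hH0 : Tendsto H (𝓝[≠] 0) (𝓝 (Q.eval 0 * 0)) :=
      (Q.continuous.continuousAt.mono_left nhdsWithin_le_nhds).mul hF₀
    rw [mul_zero] at hH0
    exact tendsto_nhds_unique ((hGan 0 hzero).continuousAt.mono_left nhdsWithin_le_nhds)
      (hH0.congr' (hGH 0 hzero).symm)
  obtain ⟨P, hP, hPG, hPf⟩ := exists_diffContOnCl_eqOn_ball hGdiff hboundary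
  refine ⟨P, hP, hPf, (hPG hzero).trans hG0, fun a ha => ?_⟩
  rw [hPG ha.1]
  refine (meromorphicNFOn_toMeromorphicNFOn H _ ha.1).meromorphicOrderAt_eq_zero_iff.1 ?_
  rw [meromorphicOrderAt_toMeromorphicNFOn hH ha.1]
  exact meromorphicOrderAt_polePoly_mul h.meromorphic hfin ha

/-! ### Inverse scattering -/

theorem sobolevDiskAlgebra.mul_apply (f g : sobolevDiskAlgebra) (z : ℂ) :
    (f * g).1 z = f.1 z * g.1 z := rfl

theorem sobolevDiskAlgebra.bezout_apply {a b f g : sobolevDiskAlgebra} (h : a * f + b * g = 1)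
    (z : ℂ) : a.1 z * f.1 z + b.1 z * g.1 z = 1 :=
  congrFun (congrArg Subtype.val h) z

theorem sobolevDiskAlgebra.apply_ne_zero {f : sobolevDiskAlgebra} (hf : IsUnit f) (z : ℂ) :
    f.1 z ≠ 0 := by
  obtain ⟨g, hg⟩ := hf.exists_right_inv
  exact left_ne_zero_of_mul_eq_one (congrFun (congrArg Subtype.val hg) z)

theorem neg_natCast_add_one_injective : Function.Injective fun n : ℕ => -((n : ℤ) + 1) :=
  fun m n h => by simpa using h

theorem IsSobolevCircle.exists_two_mul_re_eq {u : AngleCircle → ℝ} (hu : IsSobolevCircle u) :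
    ∃ U ∈ sobolevDiskAlgebra, ∀ x, 2 * (U (unitPoint x)).re = u x := by
  have hu : IsSobolevCircle fun x => (u x : ℂ) :=
    hu.comp_contDiffAt fun x => Complex.ofRealCLM.contDiff.contDiffAt
  let c : ℤ → ℂ := fourierCoeff fun x => (u x : ℂ)
  have hc : Summable fun n : ℕ => ‖c n‖ :=
    (hu.summable_norm_fourierCoeff.comp_injective Nat.cast_injective :)
  have hcw : Summable fun n : ℕ => (n * ‖c n‖) ^ 2 :=
    (hu.summable_sq_mul_norm_fourierCoeff.comp_injective Nat.cast_injective :)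
  have hneg (n : ℤ) : c (-n) = conj (c n) := by
    simpa only [Complex.conj_ofReal, neg_neg] using fourierCoeff_conj (fun x => (u x : ℂ)) (-n)
  have hreal : ((c 0).re : ℂ) = c 0 := Complex.conj_eq_iff_re.1 (by rw [← hneg, neg_zero])
  refine ⟨powerSum (fun n => c n) - algebraMap ℂ (ℂ → ℂ) (c 0 / 2),
    sub_mem (sobolevDiskAlgebra.powerSum_mem hc hcw) (sobolevDiskAlgebra.algebraMap_mem _),
    fun x => ?_⟩
  have hhalf : HasSum (fun n : ℕ => c n * unitPoint x ^ n)
      (powerSum (fun n => c n) (unitPoint x)) :=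
    (summable_powerSum hc (norm_unitPoint x).le).hasSum
  have hpair : HasSum (fun n : ℕ => c n * unitPoint x ^ n + conj (c n * unitPoint x ^ n))
      (u x + c 0) := by
    convert (hu.hasSum_fourier x).nat_add_neg using 2 with n
    · change _ = c n * unitPoint x ^ (n : ℤ) + c (-n) * unitPoint x ^ (-(n : ℤ))
      rw [hneg, map_mul, zpow_natCast, zpow_neg, zpow_natCast, map_pow,
        ← Complex.inv_eq_conj (norm_unitPoint x), inv_pow]
    · rw [zpow_zero, mul_one]
  have hre := congrArg Complex.re (hpair.unique (hhalf.add ((Complex.hasSum_conj' ..).2 hhalf)))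
  rw [← hreal] at hre
  simp only [Complex.add_re, Complex.conj_re, Complex.ofReal_re] at hre
  change 2 * (powerSum (fun n => c n) (unitPoint x) - c 0 / 2).re = u x
  rw [Complex.sub_re, Complex.div_ofNat_re]
  linarith

/-- The outer function with modulus `v ^ (-1 / 2)` on the circle is `exp (-U)`, where `2 Re U` has
the boundary values `log v`. -/
theorem IsSobolevCircle.exists_isUnit_sq_norm_mul_eq_one {v : AngleCircle → ℝ}
    (hv : IsSobolevCircle v) (hpos : ∀ x, 0 < v x) :
    ∃ V : sobolevDiskAlgebra, IsUnit V ∧ ∀ x, ‖V.1 (unitPoint x)‖ ^ 2 * v x = 1 := by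
  have hlog : IsSobolevCircle fun x => Real.log (v x) :=
    hv.comp_contDiffAt fun x => Real.contDiffAt_log.2 (hpos x).ne'
  obtain ⟨U, hU, hre⟩ := hlog.exists_two_mul_re_eq
  refine ⟨_, sobolevDiskAlgebra.isUnit_exp (neg_mem hU), fun x => ?_⟩
  change ‖Complex.exp (-U (unitPoint x))‖ ^ 2 * v x = 1
  rw [Complex.norm_exp, ← Real.exp_nat_mul, Complex.neg_re, Nat.cast_ofNat, mul_neg, hre,
    Real.exp_neg, Real.exp_log (hpos x), inv_mul_cancel₀ (hpos x).ne']

theorem exists_isUnit_sq_norm_mul_add_eq_one {f g : sobolevDiskAlgebra} (h : IsCoprime f g) :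
    ∃ V : sobolevDiskAlgebra, IsUnit V ∧
      ∀ x, ‖(f * V).1 (unitPoint x)‖ ^ 2 + ‖(g * V).1 (unitPoint x)‖ ^ 2 = 1 := by
  obtain ⟨a, b, hab⟩ := h
  have hv : IsSobolevCircle fun x => ‖f.1 (unitPoint x)‖ ^ 2 + ‖g.1 (unitPoint x)‖ ^ 2 :=
    (f.2.2.prodMk g.2.2).comp_contDiffAt (φ := fun p => ‖p.1‖ ^ 2 + ‖p.2‖ ^ 2) fun _ =>
      ((contDiff_fst.norm_sq ℝ).add (contDiff_snd.norm_sq ℝ)).contDiffAt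
  have hpos (x : AngleCircle) : 0 < ‖f.1 (unitPoint x)‖ ^ 2 + ‖g.1 (unitPoint x)‖ ^ 2 := by
    have hbezout : a.1 (unitPoint x) * f.1 (unitPoint x) +
        b.1 (unitPoint x) * g.1 (unitPoint x) = 1 := sobolevDiskAlgebra.bezout_apply hab _
    contrapose! hbezout
    have hf : ‖f.1 (unitPoint x)‖ ^ 2 = 0 := by nlinarith [sq_nonneg ‖g.1 (unitPoint x)‖]
    have hg : ‖g.1 (unitPoint x)‖ ^ 2 = 0 := by nlinarith [sq_nonneg ‖f.1 (unitPoint x)‖]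
    rw [norm_eq_zero.1 (pow_eq_zero_iff two_ne_zero |>.1 hf),
      norm_eq_zero.1 (pow_eq_zero_iff two_ne_zero |>.1 hg), mul_zero, mul_zero, add_zero]
    exact zero_ne_one
  obtain ⟨V, hV, hnorm⟩ := hv.exists_isUnit_sq_norm_mul_eq_one hpos
  refine ⟨V, hV, fun x => ?_⟩
  rw [sobolevDiskAlgebra.mul_apply, sobolevDiskAlgebra.mul_apply, norm_mul, norm_mul, ← hnorm x]
  ring

theorem IsMeromorphicExtension.exists_isCoprime_numerator {f : Circle → ℂ} {F : ℂ → ℂ}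
    (h : IsMeromorphicExtension f F) (hF₀ : Tendsto F (𝓝[≠] 0) (𝓝 0))
    (hf : IsSobolevCircle fun x => f (AddCircle.toCircle x)) (hfin : (diskPoles F).Finite) :
    ∃ P : sobolevDiskAlgebra,
      IsCoprime (Polynomial.aeval sobolevDiskAlgebra.coord (polePoly hfin)) P ∧ P.1 0 = 0 ∧
        ∀ w : Circle, P.1 w = (polePoly hfin).eval (w : ℂ) * f w := by
  obtain ⟨P, hP, hPf, hP0, hPpole⟩ := h.exists_numerator hF₀ hfin
  let Q : sobolevDiskAlgebra := Polynomial.aeval sobolevDiskAlgebra.coord (polePoly hfin)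
  have hQ (z : ℂ) : Q.1 z = (polePoly hfin).eval z := sobolevDiskAlgebra.aeval_coord_apply _ z
  lift P to sobolevDiskAlgebra using ⟨hP, by simpa only [hPf, ← hQ] using Q.2.2.mul hf⟩
  exact ⟨P, (isCoprime_aeval_polePoly hfin hPpole).symm, hP0, hPf⟩

theorem IsMeromorphicExtension.exists_isCoprime_normalized {f : Circle → ℂ} {F : ℂ → ℂ}
    (h : IsMeromorphicExtension f F) (hF₀ : Tendsto F (𝓝[≠] 0) (𝓝 0))
    (hf : IsSobolevCircle fun x => f (AddCircle.toCircle x)) :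
    ∃ A B : sobolevDiskAlgebra, IsCoprime A B ∧ A.1 0 ≠ 0 ∧ B.1 0 = 0 ∧
      (∀ x, ‖A.1 (unitPoint x)‖ ^ 2 + ‖B.1 (unitPoint x)‖ ^ 2 = 1) ∧
      ∀ w : Circle, B.1 w = A.1 w * f w := by
  have hfin := h.finite_diskPoles
  obtain ⟨P, hcoprime, hP0, hPf⟩ := h.exists_isCoprime_numerator hF₀ hf hfin
  let Q : sobolevDiskAlgebra := Polynomial.aeval sobolevDiskAlgebra.coord (polePoly hfin)
  have hQ (z : ℂ) : Q.1 z = (polePoly hfin).eval z := sobolevDiskAlgebra.aeval_coord_apply _ z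
  obtain ⟨V, hV, hnorm⟩ := exists_isUnit_sq_norm_mul_add_eq_one hcoprime
  have hV0 : V.1 0 ≠ 0 := sobolevDiskAlgebra.apply_ne_zero hV 0
  refine ⟨Q * V, P * V, ?_⟩
  refine ⟨(isCoprime_mul_unit_right hV _ _).2 hcoprime, ?_, ?_, hnorm, fun w => ?_⟩
  · rw [sobolevDiskAlgebra.mul_apply, hQ]
    exact mul_ne_zero
      (eval_polePoly_ne_zero hfin (zero_notMem_diskPoles h.meromorphic hF₀)) hV0
  · rw [sobolevDiskAlgebra.mul_apply, hP0, zero_mul]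
  · rw [sobolevDiskAlgebra.mul_apply, sobolevDiskAlgebra.mul_apply, hPf, hQ]
    ring

theorem hasSum_fourierCoeff_mul_add (f g : sobolevDiskAlgebra) {l : AngleCircle → ℂ}
    (hl : Continuous l) {m : ℤ} (hm : m < 0) :
    HasSum (fun n : ℕ => fourierCoeff (fun x => f.1 (unitPoint x)) n * fourierCoeff l (m - n))
      (fourierCoeff (fun x => f.1 (unitPoint x) * l x + g.1 (unitPoint x)) m) := by
  have hadd := congrFun (fourierCoeff.add (integrable_haarAddCircle (f.2.2.continuous.mul hl))
    (integrable_haarAddCircle g.2.2.continuous)) m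
  rw [Pi.add_apply, fourierCoeff_eq_zero_of_neg g.2.1 hm, add_zero] at hadd
  have hprod := hasSum_fourierCoeff_mul f.2.2.continuous hl
    f.2.2.summable_norm_fourierCoeff.of_norm m
  rw [← (Nat.cast_injective (R := ℤ)).hasSum_iff fun k hk => ?_] at hprod
  · exact hadd.symm ▸ hprod
  · rw [fourierCoeff_eq_zero_of_neg f.2.1, zero_mul]
    exact not_le.1 fun h0 => hk ⟨k.toNat, Int.toNat_of_nonneg h0⟩

/-- The first sequence of the Marchenko data of `(A, B)` consists of the Taylor coefficients of
`A`, the second of those of `B z / z`. -/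
noncomputable def taylorPair (A B : sobolevDiskAlgebra) : (ℕ → ℂ) × (ℕ → ℂ) :=
  (fun n => fourierCoeff (fun x => A.1 (unitPoint x)) n,
    fun n => fourierCoeff (fun x => B.1 (unitPoint x)) (n + 1))

theorem taylorPair_fst (A B : sobolevDiskAlgebra) (n : ℕ) :
    (taylorPair A B).1 n = fourierCoeff (fun x => A.1 (unitPoint x)) n := rfl

theorem taylorPair_snd (A B : sobolevDiskAlgebra) (n : ℕ) :
    (taylorPair A B).2 n = fourierCoeff (fun x => B.1 (unitPoint x)) (n + 1) := rfl

/-- With `D A + E B = 1` and `l = (conj B - E) / A`, the relation `|A|² + |B|² = 1` on the circle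
becomes the pair `conj B = A l + E`, `conj A = D - B l`. The negative Fourier coefficients of these
two identities are the Marchenko equations, because those of `D` and `E` vanish. -/
theorem isMarchenkoSolution_taylorPair {A B D E : sobolevDiskAlgebra} (hA0 : A.1 0 ≠ 0)
    (hB0 : B.1 0 = 0) {l : AngleCircle → ℂ} (hl : IsSobolevCircle l)
    (hB : ∀ x, conj (B.1 (unitPoint x)) = A.1 (unitPoint x) * l x + E.1 (unitPoint x))
    (hA : ∀ x, conj (A.1 (unitPoint x)) = (-B).1 (unitPoint x) * l x + D.1 (unitPoint x)) :
    IsMarchenkoSolution (fun n => fourierCoeff l (-(n + 1))) (taylorPair A B) where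
  summable_kernel := hl.summable_norm_fourierCoeff.comp_injective neg_natCast_add_one_injective
  summable_fst := sobolevDiskAlgebra.summable_norm_fourierCoeff_natCast A
  summable_snd := by
    have hsum := sobolevDiskAlgebra.summable_norm_fourierCoeff_natCast B
    simpa only [taylorPair_snd, Nat.cast_succ] using (summable_nat_add_iff 1).2 hsum
  fst_zero_ne_zero := by
    rwa [taylorPair_fst, Nat.cast_zero, fourierCoeff_zero_of_diffContOnCl A.2.1]
  conj_snd m := by
    have hsum := hasSum_fourierCoeff_mul_add A E hl.continuous (m := -((m : ℤ) + 1)) (by lia)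
    simp only [← hB, fourierCoeff_conj, neg_neg] at hsum
    rw [taylorPair_snd, ← hsum.tsum_eq]
    refine tsum_congr fun n => ?_
    rw [mul_comm, taylorPair_fst]
    push_cast
    ring_nf
  conj_fst_succ m := by
    have hsum := hasSum_fourierCoeff_mul_add (-B) D hl.continuous (m := -((m : ℤ) + 1)) (by lia)
    have hneg (n : ℤ) : fourierCoeff (fun x => (-B).1 (unitPoint x)) n =
        -fourierCoeff (fun x => B.1 (unitPoint x)) n := by
      change fourierCoeff (fun x => -B.1 (unitPoint x)) n = _
      simpa only [neg_one_mul] using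
        fourierCoeff.const_mul (fun x : AngleCircle => B.1 (unitPoint x)) (-1) n
    simp only [← hA, fourierCoeff_conj, neg_neg, hneg] at hsum
    rw [taylorPair_fst, Nat.cast_succ, ← hsum.tsum_eq, hsum.summable.tsum_eq_zero_add,
      Nat.cast_zero, fourierCoeff_zero_of_diffContOnCl B.2.1, hB0, neg_zero, zero_mul, zero_add,
      ← tsum_neg]
    refine tsum_congr fun n => ?_
    rw [neg_mul, mul_comm, taylorPair_snd]
    push_cast
    ring_nf

theorem IsSobolevCircle.summable_tsum_norm_fourierCoeff_neg_pow_three {l : AngleCircle → ℂ}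
    (hl : IsSobolevCircle l) :
    Summable fun k : ℕ => (∑' n : ℕ, ‖fourierCoeff l (-(((n + k : ℕ) : ℤ) + 1))‖) ^ 3 := by
  have hsum : Summable fun n : ℕ =>
      (((-((n : ℤ) + 1) : ℤ) : ℝ) * ‖fourierCoeff l (-((n : ℤ) + 1))‖) ^ 2 :=
    (hl.summable_sq_mul_norm_fourierCoeff.comp_injective neg_natCast_add_one_injective :)
  refine summable_tsum_norm_tail_pow_three (x := fun n : ℕ => fourierCoeff l (-((n : ℤ) + 1)))
    (hsum.congr fun n => ?_)
  push_cast
  ring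

theorem exists_isMarchenkoSolution_taylorPair {A B : sobolevDiskAlgebra} (h : IsCoprime A B)
    (hA : ∀ x, A.1 (unitPoint x) ≠ 0) (hA0 : A.1 0 ≠ 0) (hB0 : B.1 0 = 0)
    (hnorm : ∀ x, ‖A.1 (unitPoint x)‖ ^ 2 + ‖B.1 (unitPoint x)‖ ^ 2 = 1) :
    ∃ κ, IsMarchenkoSolution κ (taylorPair A B) ∧
      Summable fun k => (∑' n, ‖κ (n + k)‖) ^ 3 := by
  obtain ⟨D, E, hbezout⟩ := h
  let l (x : AngleCircle) : ℂ :=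
    (conj (B.1 (unitPoint x)) - E.1 (unitPoint x)) * (A.1 (unitPoint x))⁻¹
  have hl : IsSobolevCircle l := (B.2.2.star.sub E.2.2).mul (A.2.2.inv hA)
  have hAl (x : AngleCircle) :
      A.1 (unitPoint x) * l x = conj (B.1 (unitPoint x)) - E.1 (unitPoint x) := by
    rw [mul_left_comm, mul_inv_cancel₀ (hA x), mul_one]
  refine ⟨fun n => fourierCoeff l (-(n + 1)), ?_,
    hl.summable_tsum_norm_fourierCoeff_neg_pow_three⟩
  refine isMarchenkoSolution_taylorPair (D := D) (E := E) hA0 hB0 hl ?_ ?_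
  · intro x
    rw [hAl, sub_add_cancel]
  · intro x
    refine mul_left_cancel₀ (hA x) ?_
    have hone : A.1 (unitPoint x) * conj (A.1 (unitPoint x)) +
        B.1 (unitPoint x) * conj (B.1 (unitPoint x)) = 1 := by
      rw [Complex.mul_conj', Complex.mul_conj']
      exact_mod_cast hnorm x
    change _ = A.1 (unitPoint x) * (-B.1 (unitPoint x) * l x + D.1 (unitPoint x))
    linear_combination hone - sobolevDiskAlgebra.bezout_apply hbezout (unitPoint x) +
      B.1 (unitPoint x) * hAl x

theorem dataSpinor_taylorPair (A B : sobolevDiskAlgebra) (hB0 : B.1 0 = 0) (w : Circle) :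
    dataSpinor (taylorPair A B) w = (A.1 w, B.1 w) := by
  obtain ⟨x, rfl⟩ := toCircle_surjective w
  exact Prod.ext (sobolevDiskAlgebra.eq_powerSum A x).symm
    (sobolevDiskAlgebra.eq_mul_powerSum B hB0 x).symm

theorem IsMeromorphicExtension.exists_isRephasedPulse {r₀ : Circle → ℂ} {F : ℂ → ℂ}
    (h : IsMeromorphicExtension r₀ F) (hF₀ : Tendsto F (𝓝[≠] 0) (𝓝 0))
    (hr₀ : IsSobolevCircle fun x => r₀ (AddCircle.toCircle x)) {M : Circle → Fin 3 → ℝ} {ρ : ℤ}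
    (hM : ∀ w, M w = hopf (1, (w : ℂ) ^ (-ρ) * r₀ w)) :
    ∃ ω, IsRephasedPulse ρ M ω := by
  obtain ⟨A, B, hcoprime, hA0, hB0, hnorm, hAB⟩ := h.exists_isCoprime_normalized hF₀ hr₀
  have hA (w : Circle) : A.1 w ≠ 0 := fun hzero => by
    obtain ⟨x, rfl⟩ := toCircle_surjective w
    have hB := hAB (AddCircle.toCircle x)
    rw [hzero, zero_mul] at hB
    have hone := hnorm x
    rw [hzero, hB, norm_zero, zero_pow two_ne_zero, add_zero] at hone
    exact zero_ne_one hone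
  obtain ⟨κ, hsol, hκ⟩ := exists_isMarchenkoSolution_taylorPair hcoprime
    (fun x => hA (AddCircle.toCircle x)) hA0 hB0 hnorm
  refine ⟨_, hsol.isRephasedPulse hκ (r₀ := r₀) (fun w => ?_) hM⟩
  rw [dataSpinor_taylorPair A B hB0]
  exact ⟨hA w, hAB w⟩

/-! ### Direct scattering -/

section Scattering

/-- The spinor produced from equilibrium by the hard pulses with parameters `γ (n - 1), …, γ 0`, in
this order, each followed by precession by `z`. -/
noncomputable def spinor (z : ℂ) : ℕ → (ℕ → ℂ) → ℂ × ℂ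
  | 0, _ => (1, 0)
  | n + 1, γ => spinorStep (γ 0) z (spinor z n fun k => γ (k + 1))

theorem spinorStep_sub (c z : ℂ) (s t : ℂ × ℂ) :
    spinorStep c z (s - t) = spinorStep c z s - spinorStep c z t := by
  simp only [spinorStep, Prod.ext_iff, Prod.fst_sub, Prod.snd_sub]
  constructor <;> ring

theorem norm_spinorStep_le (c : ℂ) {z : ℂ} (hz : ‖z‖ ≤ 1) (s : ℂ × ℂ) :
    ‖spinorStep c z s‖ ≤ (1 + ‖c‖) * ‖s‖ := by
  have h1 := norm_fst_le s
  have h2 := norm_snd_le s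
  refine max_le ?_ ?_
  · calc ‖s.1 - conj c * s.2‖ ≤ ‖s.1‖ + ‖c‖ * ‖s.2‖ := by
          simpa only [norm_mul, RCLike.norm_conj] using norm_sub_le s.1 (conj c * s.2)
      _ ≤ ‖s‖ + ‖c‖ * ‖s‖ := by gcongr
      _ = (1 + ‖c‖) * ‖s‖ := by ring
  · calc ‖z * (s.2 + c * s.1)‖ ≤ ‖s.2‖ + ‖c‖ * ‖s.1‖ := by
          rw [norm_mul, ← norm_mul c]
          exact (mul_le_of_le_one_left (norm_nonneg _) hz).trans (norm_add_le _ _)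
      _ ≤ ‖s‖ + ‖c‖ * ‖s‖ := by gcongr
      _ = (1 + ‖c‖) * ‖s‖ := by ring

theorem continuous_spinorStep (c z : ℂ) : Continuous (spinorStep c z) := by
  unfold spinorStep
  fun_prop

theorem spinor_zero_left (n : ℕ) (γ : ℕ → ℂ) : spinor 0 n γ = (1, 0) := by
  induction n generalizing γ with
  | zero => rfl
  | succ n ih => simp only [spinor, spinorStep, ih, mul_zero, sub_zero, zero_mul]

theorem spinor_ne_zero {z : ℂ} (hz : z ≠ 0) (n : ℕ) (γ : ℕ → ℂ) : spinor z n γ ≠ 0 := by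
  induction n generalizing γ with
  | zero => simp [spinor]
  | succ n ih => exact (spinorStep_eq_zero_iff _ hz).not.2 (ih _)

theorem differentiable_spinor (n : ℕ) (γ : ℕ → ℂ) : Differentiable ℂ fun z => spinor z n γ := by
  induction n generalizing γ with
  | zero => exact differentiable_const _
  | succ n ih =>
    have := ih fun k => γ (k + 1)
    unfold spinor spinorStep
    fun_prop

theorem spinorNormSq_spinor {z : ℂ} (hz : ‖z‖ = 1) (n : ℕ) (γ : ℕ → ℂ) :
    spinorNormSq (spinor z n γ) = ∏ i ∈ Finset.range n, (1 + ‖γ i‖ ^ 2) := by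
  induction n generalizing γ with
  | zero => simp [spinor, spinorNormSq]
  | succ n ih =>
    rw [spinor, spinorNormSq_spinorStep _ hz, ih, Finset.prod_range_succ', mul_comm]

theorem norm_spinor_succ_sub_le {z : ℂ} (hz : ‖z‖ ≤ 1) (n : ℕ) (γ : ℕ → ℂ) :
    ‖spinor z (n + 1) γ - spinor z n γ‖ ≤ (∏ i ∈ Finset.range n, (1 + ‖γ i‖)) * ‖γ n‖ := by
  induction n generalizing γ with
  | zero => simpa [spinor, spinorStep] using mul_le_of_le_one_left (norm_nonneg (γ 0)) hz
  | succ n ih =>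
    have hstep (n : ℕ) : spinor z (n + 1) γ =
      spinorStep (γ 0) z (spinor z n fun k => γ (k + 1)) := rfl
    rw [hstep (n + 1), hstep n, ← spinorStep_sub, Finset.prod_range_succ', mul_right_comm, mul_comm]
    exact (norm_spinorStep_le _ hz _).trans (by gcongr; exact ih _)

variable {γ : ℕ → ℂ} (hγ : Summable fun n => ‖γ n‖) {z : ℂ}
include hγ

theorem prod_one_add_norm_le_exp_tsum (n : ℕ) :
    ∏ i ∈ Finset.range n, (1 + ‖γ i‖) ≤ Real.exp (∑' n, ‖γ n‖) :=
  calc ∏ i ∈ Finset.range n, (1 + ‖γ i‖)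
      ≤ ∏ i ∈ Finset.range n, Real.exp ‖γ i‖ :=
        Finset.prod_le_prod (fun _ _ => by positivity) fun i _ => by
          simpa only [add_comm] using Real.add_one_le_exp ‖γ i‖
    _ = Real.exp (∑ i ∈ Finset.range n, ‖γ i‖) := (Real.exp_sum _ _).symm
    _ ≤ Real.exp (∑' n, ‖γ n‖) :=
        Real.exp_le_exp.2 (hγ.sum_le_tsum _ fun _ _ => norm_nonneg _)

theorem norm_spinor_succ_sub_le_exp (hz : ‖z‖ ≤ 1) (n : ℕ) :
    ‖spinor z (n + 1) γ - spinor z n γ‖ ≤ Real.exp (∑' n, ‖γ n‖) * ‖γ n‖ :=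
  (norm_spinor_succ_sub_le hz n γ).trans
    (mul_le_mul_of_nonneg_right (prod_one_add_norm_le_exp_tsum hγ n) (norm_nonneg _))

omit hγ in
/-- The limit of `spinor z n γ` as `n → ∞`: the spinor produced by infinitely many pulses. -/
noncomputable def scatteringSpinor (γ : ℕ → ℂ) (z : ℂ) : ℂ × ℂ :=
  (1, 0) + ∑' n, (spinor z (n + 1) γ - spinor z n γ)

omit hγ in
theorem scatteringSpinor_zero (γ : ℕ → ℂ) : scatteringSpinor γ 0 = (1, 0) := by
  simp only [scatteringSpinor, spinor_zero_left, sub_self, tsum_zero, add_zero]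

theorem tendsto_spinor (hz : ‖z‖ ≤ 1) :
    Tendsto (fun n => spinor z n γ) atTop (𝓝 (scatteringSpinor γ z)) := by
  have hsum : Summable fun n => spinor z (n + 1) γ - spinor z n γ :=
    .of_norm_bounded (hγ.mul_left _) (norm_spinor_succ_sub_le_exp hγ hz)
  have hlim := hsum.hasSum.tendsto_sum_nat.const_add (1, 0)
  simp only [Finset.sum_range_sub fun n => spinor z n γ] at hlim
  exact hlim.congr fun n => add_sub_cancel _ _

theorem diffContOnCl_scatteringSpinor : DiffContOnCl ℂ (scatteringSpinor γ) (Metric.ball 0 1) := by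
  have hd (n : ℕ) : Differentiable ℂ fun z => spinor z (n + 1) γ - spinor z n γ :=
    (differentiable_spinor (n + 1) γ).sub (differentiable_spinor n γ)
  refine DiffContOnCl.const_add ⟨?_, ?_⟩ _
  · exact Complex.differentiableOn_tsum_of_summable_norm (hγ.mul_left _)
      (fun n => (hd n).differentiableOn) Metric.isOpen_ball fun n z hz =>
      norm_spinor_succ_sub_le_exp hγ (mem_ball_zero_iff.1 hz).le n
  · rw [closure_ball 0 one_ne_zero]
    exact continuousOn_tsum (fun n => (hd n).continuous.continuousOn) (hγ.mul_left _)
      fun n z hz => norm_spinor_succ_sub_le_exp hγ (mem_closedBall_zero_iff.1 hz) n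

theorem norm_scatteringSpinor_sub_le (hz : ‖z‖ ≤ 1) :
    ‖scatteringSpinor γ z - (1, 0)‖ ≤ Real.exp (∑' n, ‖γ n‖) * ∑' n, ‖γ n‖ := by
  rw [scatteringSpinor, add_sub_cancel_left, ← tsum_mul_left]
  exact tsum_of_norm_bounded (hγ.mul_left _).hasSum (norm_spinor_succ_sub_le_exp hγ hz)

theorem scatteringSpinor_eq_spinorStep (hz : ‖z‖ ≤ 1) :
    scatteringSpinor γ z = spinorStep (γ 0) z (scatteringSpinor (fun k => γ (k + 1)) z) :=
  tendsto_nhds_unique ((tendsto_add_atTop_iff_nat 1).2 (tendsto_spinor hγ hz))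
    (((continuous_spinorStep _ z).tendsto _).comp
      (tendsto_spinor ((summable_nat_add_iff 1).2 hγ) hz))

theorem tendsto_prod_one_add_sq_norm (hz : ‖z‖ = 1) :
    Tendsto (fun n => ∏ i ∈ Finset.range n, (1 + ‖γ i‖ ^ 2)) atTop
      (𝓝 (spinorNormSq (scatteringSpinor γ z))) := by
  have hcont : Continuous spinorNormSq := by
    unfold spinorNormSq
    fun_prop
  simpa only [Function.comp_def, spinorNormSq_spinor hz] using
    (hcont.tendsto _).comp (tendsto_spinor hγ hz.le)

theorem scatteringSpinor_shift_eq_zero (hz : ‖z‖ ≤ 1) (hz0 : z ≠ 0)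
    (h : scatteringSpinor γ z = 0) (k : ℕ) : scatteringSpinor (fun n => γ (n + k)) z = 0 := by
  induction k with
  | zero => exact h
  | succ k ih =>
    rw [scatteringSpinor_eq_spinorStep ((summable_nat_add_iff k).2 hγ) hz,
      spinorStep_eq_zero_iff _ hz0] at ih
    simpa only [add_assoc, add_comm 1 k] using ih

theorem scatteringSpinor_ne_zero (hz : ‖z‖ ≤ 1) : scatteringSpinor γ z ≠ 0 := by
  intro h
  rcases eq_or_ne z 0 with rfl | hz0
  · simp [scatteringSpinor_zero] at h
  have htail := tendsto_tsum_norm_tail γ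
  have hlim : Tendsto (fun k => Real.exp (∑' n, ‖γ (n + k)‖) * ∑' n, ‖γ (n + k)‖) atTop (𝓝 0) := by
    simpa using htail.rexp.mul htail
  obtain ⟨k, hk⟩ := (hlim.eventually_lt_const one_pos).exists
  have hle := norm_scatteringSpinor_sub_le ((summable_nat_add_iff k).2 hγ) hz
  rw [scatteringSpinor_shift_eq_zero hγ hz hz0 h k] at hle
  simp only [zero_sub, norm_neg, Prod.norm_mk, norm_one, norm_zero, zero_le_one, sup_of_le_left]
    at hle
  linarith

theorem hasSum_log_one_add_sq_norm (hz : ‖z‖ = 1) :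
    HasSum (fun n => Real.log (1 + ‖γ n‖ ^ 2))
      (Real.log (spinorNormSq (scatteringSpinor γ z))) := by
  have hpos := spinorNormSq_pos (scatteringSpinor_ne_zero hγ hz.le)
  rw [hasSum_iff_tendsto_nat_of_nonneg fun n => Real.log_nonneg (by nlinarith [sq_nonneg ‖γ n‖])]
  refine ((tendsto_prod_one_add_sq_norm hγ hz).log hpos.ne').congr fun n => ?_
  exact Real.log_prod fun i _ => by positivity

end Scattering

section Uniqueness

/-- The parameters of the pulses of `ω` before time `ρ`, listed backwards in time. -/
noncomputable def paramsBefore (ω : ℤ → ℂ) (ρ : ℤ) (k : ℕ) : ℂ := pulseParam (ω (ρ - 1 - k))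

theorem paramsBefore_succ (ω : ℤ → ℂ) (ρ : ℤ) (k : ℕ) :
    paramsBefore ω ρ (k + 1) = paramsBefore ω (ρ - 1) k := by
  rw [paramsBefore, paramsBefore, Nat.cast_succ]
  congr 2
  ring

theorem norm_pulseParam_le {c : ℂ} (hc : ‖c‖ ≤ 2) : ‖pulseParam c‖ ≤ ‖c‖ := by
  have hπ := Real.pi_gt_three
  have h0 := norm_nonneg c
  have hsin : Real.sin (‖c‖ / 2) ≤ ‖c‖ / 2 := Real.sin_le (by linarith)
  have hcos : 1 / 2 ≤ Real.cos (‖c‖ / 2) := by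
    nlinarith [Real.one_sub_sq_div_two_le_cos (x := ‖c‖ / 2)]
  rw [norm_pulseParam (by linarith), Real.tan_eq_sin_div_cos, div_le_iff₀ (by linarith)]
  nlinarith

theorem summable_norm_paramsBefore {ω : ℤ → ℂ} (hω : Summable fun j => ‖ω j‖) (ρ : ℤ) :
    Summable fun k => ‖paramsBefore ω ρ k‖ := by
  have hs : Summable fun k : ℕ => ‖ω (ρ - 1 - k)‖ :=
    hω.comp_injective (sub_one_sub_natCast_injective ρ)
  refine Summable.of_norm_bounded_eventually_nat hs ?_
  filter_upwards [hs.tendsto_atTop_zero.eventually_le_const (zero_lt_two (α := ℝ))] with k hk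
  rw [norm_norm]
  exact norm_pulseParam_le hk

variable {ω : ℤ → ℂ} {w : Circle} {m : ℤ → Fin 3 → ℝ}
  (hm : ∀ j, m (j + 1) = precession w (pulseRotation (ω j) (m j)))
include hm

theorem dotProduct_self_sub_hopf_spinor (hω : ∀ j, ‖ω j‖ < Real.pi) (n : ℕ) (ρ : ℤ) :
    (m ρ - hopf (spinor w n (paramsBefore ω ρ))) ⬝ᵥ (m ρ - hopf (spinor w n (paramsBefore ω ρ))) =
      (m (ρ - n) - ![0, 0, 1]) ⬝ᵥ (m (ρ - n) - ![0, 0, 1]) := by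
  induction n generalizing ρ with
  | zero => rw [spinor, hopf_one_zero, Nat.cast_zero, sub_zero]
  | succ n ih =>
    have hmρ : m ρ = precession w (pulseRotation (ω (ρ - 1)) (m (ρ - 1))) := by
      rw [← hm, sub_add_cancel]
    have h0 : paramsBefore ω ρ 0 = pulseParam (ω (ρ - 1)) := by
      rw [paramsBefore, Nat.cast_zero, sub_zero]
    simp only [spinor, paramsBefore_succ, h0]
    rw [← precession_pulseRotation_hopf w (hω _) (spinor_ne_zero w.coe_ne_zero n _), hmρ,
      ← precession_sub, precession_dotProduct_self, ← pulseRotation_sub,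
      pulseRotation_dotProduct_self, ih, Nat.cast_succ, sub_sub, add_comm 1]

theorem eq_hopf_scatteringSpinor (hsum : Summable fun j => ‖ω j‖) (hω : ∀ j, ‖ω j‖ < Real.pi)
    (hlim : Tendsto m atBot (𝓝 ![0, 0, 1])) (ρ : ℤ) :
    m ρ = hopf (scatteringSpinor (paramsBefore ω ρ) w) := by
  have hw := Circle.norm_coe w
  have hs := summable_norm_paramsBefore hsum ρ
  have hdot : Continuous fun v : Fin 3 → ℝ => v ⬝ᵥ v := continuous_id.dotProduct continuous_id
  have hspinor := (hdot.tendsto _).comp ((tendsto_const_nhds (x := m ρ)).sub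
    ((continuousAt_hopf (scatteringSpinor_ne_zero hs hw.le)).tendsto.comp
      (tendsto_spinor hs hw.le)))
  have hbot : Tendsto (fun n : ℕ => ρ - (n : ℤ)) atTop atBot :=
    tendsto_atBot_add_const_left _ _ (tendsto_neg_atTop_atBot.comp tendsto_natCast_atTop_atTop)
  have hequilibrium := (hdot.tendsto _).comp ((hlim.comp hbot).sub_const ![0, 0, 1])
  have hdist := tendsto_nhds_unique hspinor
    (hequilibrium.congr fun n => (dotProduct_self_sub_hopf_spinor hm hω n ρ).symm)
  rw [sub_self, zero_dotProduct, dotProduct_self_eq_zero] at hdist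
  exact sub_eq_zero.1 hdist

theorem eq_precession_zpow_of_rephasing {ρ : ℤ} (hω : ∀ j, ρ ≤ j → ω j = 0) {u : Fin 3 → ℝ}
    (hlim : Tendsto (fun j : ℤ => precession (w ^ (-j)) (m j)) atTop (𝓝 u)) :
    u = precession (w ^ (-ρ)) (m ρ) := by
  refine tendsto_nhds_unique hlim (tendsto_const_nhds.congr' ?_)
  filter_upwards [eventually_ge_atTop ρ] with j hj
  induction j, hj using Int.leInduction with
  | base => rfl
  | succ j hj ih =>
    rw [hm, hω j hj, pulseRotation_zero, precession_precession, ih, ← zpow_add_one]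
    congr 2
    ring

end Uniqueness

theorem IsRephasedPulse.scatteringSpinor_snd_eq {ρ : ℤ} {M : Circle → Fin 3 → ℝ} {ω : ℤ → ℂ}
    (h : IsRephasedPulse ρ M ω) {w : Circle} {r : ℂ} (hM : M w = hopf (1, (w : ℂ) ^ (-ρ) * r)) :
    (scatteringSpinor (paramsBefore ω ρ) w).2 = (scatteringSpinor (paramsBefore ω ρ) w).1 * r := by
  obtain ⟨m, hm, hbot, htop⟩ := h.transform w
  have hscatter := eq_hopf_scatteringSpinor hm h.summable h.norm_lt_pi hbot ρ
  have hmρ : m ρ = hopf (1, r) := by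
    have hprec :=
      congrArg (precession (w ^ ρ)) (eq_precession_zpow_of_rephasing hm h.rephasing htop)
    rw [precession_precession, ← zpow_add, add_neg_cancel, zpow_zero, precession_one, hM,
      precession_hopf, Circle.coe_zpow, ← mul_assoc, ← zpow_add₀ w.coe_ne_zero,
      add_neg_cancel, zpow_zero, one_mul] at hprec
    exact hprec.symm
  obtain ⟨hne, hdiv⟩ := fst_ne_zero_and_snd_div_fst_eq
    (scatteringSpinor_ne_zero (summable_norm_paramsBefore h.summable ρ) w.norm_coe.le)
    (hscatter.symm.trans hmρ)
  rw [← hdiv, mul_div_cancel₀ _ hne]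

theorem IsRephasedPulse.hasSum_log_one_add_sq_tan {ρ : ℤ} {M : Circle → Fin 3 → ℝ} {ω : ℤ → ℂ}
    (h : IsRephasedPulse ρ M ω) {z : ℂ} (hz : ‖z‖ = 1) :
    HasSum (fun j : ℤ => Real.log (1 + Real.tan (‖ω j‖ / 2) ^ 2))
      (Real.log (spinorNormSq (scatteringSpinor (paramsBefore ω ρ) z))) := by
  rw [hasSum_int_iff_of_eq_zero (ρ := ρ) fun j hj => by simp [h.rephasing j hj]]
  simpa only [paramsBefore, norm_pulseParam (h.norm_lt_pi _)] using
    hasSum_log_one_add_sq_norm (summable_norm_paramsBefore h.summable ρ) hz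

/-! ### The energy formula -/

theorem circleAverage_log_norm_of_ne_zero {f : ℂ → ℂ} {c : ℂ} {R : ℝ}
    (hf : DiffContOnCl ℂ f (Metric.ball c |R|)) (hne : ∀ z ∈ Metric.closedBall c |R|, f z ≠ 0) :
    Real.circleAverage (fun z => Real.log ‖f z‖) c R = Real.log ‖f c‖ := by
  refine InnerProductSpace.HarmonicContOnCl.circleAverage_eq ⟨fun z hz => ?_, ?_⟩
  · exact (hf.differentiableOn.analyticAt (Metric.isOpen_ball.mem_nhds hz)).harmonicAt_log_norm
      (hne z (Metric.ball_subset_closedBall hz))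
  · exact hf.continuousOn.norm.log fun z hz =>
      norm_ne_zero_iff.2 (hne z (Metric.closure_ball_subset_closedBall hz))

theorem log_norm_eval_polePoly {F : ℂ → ℂ} (hfin : (diskPoles F).Finite) {z : ℂ}
    (hz : z ∉ diskPoles F) :
    Real.log ‖(polePoly hfin).eval z‖ =
      ∑ a ∈ hfin.toFinset, (poleMultiplicity F a : ℝ) * Real.log ‖z - a‖ := by
  rw [eval_polePoly, norm_prod, Real.log_prod fun a ha => ?_]
  · simp only [norm_pow, Real.log_pow]
  · refine norm_ne_zero_iff.2 (pow_ne_zero _ (sub_ne_zero.2 ?_))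
    rintro rfl
    exact hz (hfin.mem_toFinset.1 ha)

theorem circleAverage_log_norm_eval_polePoly {F : ℂ → ℂ} (hfin : (diskPoles F).Finite) :
    Real.circleAverage (fun z => Real.log ‖(polePoly hfin).eval z‖) 0 1 = 0 := by
  have hsphere : Set.EqOn (fun z => Real.log ‖(polePoly hfin).eval z‖)
      (fun z => ∑ a ∈ hfin.toFinset, (poleMultiplicity F a : ℝ) • Real.log ‖z - a‖)
      (Metric.sphere 0 |1|) := fun z hz => by
    rw [abs_one] at hz
    exact log_norm_eval_polePoly hfin (coe_circle_notMem_diskPoles ⟨z, hz⟩)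
  rw [Real.circleAverage_congr_sphere hsphere, Real.circleAverage_fun_sum fun a _ =>
    (circleIntegrable_log_norm_sub_const 1).const_fun_smul]
  refine Finset.sum_eq_zero fun a ha => ?_
  rw [Real.circleAverage_fun_smul, circleAverage_log_norm_sub_const₀
    (mem_ball_zero_iff.1 (hfin.mem_toFinset.1 ha).1), smul_zero]

theorem exists_eq_smul_of_isCoprime {S : ℂ → ℂ × ℂ} (hS : DiffContOnCl ℂ S (Metric.ball 0 1))
    {Q P : sobolevDiskAlgebra} (h : IsCoprime Q P)
    (hcross : ∀ w : Circle, (S w).1 * P.1 w = Q.1 w * (S w).2) :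
    ∃ H : ℂ → ℂ, DiffContOnCl ℂ H (Metric.ball 0 1) ∧
      ∀ z ∈ Metric.closedBall 0 1, S z = H z • (Q.1 z, P.1 z) := by
  obtain ⟨D, E, hbezout⟩ := h
  have hS₁ : DiffContOnCl ℂ (fun z => (S z).1) (Metric.ball 0 1) :=
    (ContinuousLinearMap.fst ℂ ℂ ℂ).differentiable.comp_diffContOnCl hS
  have hS₂ : DiffContOnCl ℂ (fun z => (S z).2) (Metric.ball 0 1) :=
    (ContinuousLinearMap.snd ℂ ℂ ℂ).differentiable.comp_diffContOnCl hS
  have hcrossOn : Set.EqOn (fun z => (S z).1 * P.1 z) (fun z => Q.1 z * (S z).2)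
      (closure (Metric.ball 0 1)) := by
    refine Complex.eqOn_closure_of_eqOn_frontier Metric.isBounded_ball (hS₁.smul P.2.1)
      (Q.2.1.smul hS₂) fun w hw => ?_
    rw [frontier_ball 0 one_ne_zero] at hw
    exact hcross ⟨w, hw⟩
  refine ⟨fun z => D.1 z * (S z).1 + E.1 z * (S z).2, (D.2.1.smul hS₁).add (E.2.1.smul hS₂),
    fun z hz => ?_⟩
  rw [← closure_ball 0 one_ne_zero] at hz
  have hone := sobolevDiskAlgebra.bezout_apply hbezout z
  have hz := hcrossOn hz
  refine Prod.ext ?_ ?_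
  · change (S z).1 = (D.1 z * (S z).1 + E.1 z * (S z).2) * Q.1 z
    linear_combination -(S z).1 * hone + E.1 z * hz
  · change (S z).2 = (D.1 z * (S z).1 + E.1 z * (S z).2) * P.1 z
    linear_combination -(S z).2 * hone - D.1 z * hz

theorem circleAverage_log_norm_eval_polePoly_mul {F : ℂ → ℂ} (hfin : (diskPoles F).Finite)
    {H : ℂ → ℂ} (hH : DiffContOnCl ℂ H (Metric.ball 0 1))
    (hne : ∀ z ∈ Metric.closedBall 0 1, H z ≠ 0) :
    Real.circleAverage (fun z => Real.log ‖(polePoly hfin).eval z * H z‖) 0 1 =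
      Real.log ‖H 0‖ := by
  have hsub : Metric.sphere (0 : ℂ) 1 ⊆ Metric.closedBall 0 1 := Metric.sphere_subset_closedBall
  have hQ (z : ℂ) (hz : z ∈ Metric.sphere (0 : ℂ) 1) : ‖(polePoly hfin).eval z‖ ≠ 0 :=
    norm_ne_zero_iff.2 (eval_polePoly_coe_circle_ne_zero hfin ⟨z, hz⟩)
  have hH' (z : ℂ) (hz : z ∈ Metric.sphere (0 : ℂ) 1) : ‖H z‖ ≠ 0 :=
    norm_ne_zero_iff.2 (hne z (hsub hz))
  have hsphere : Set.EqOn (fun z => Real.log ‖(polePoly hfin).eval z * H z‖)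
      (fun z => Real.log ‖(polePoly hfin).eval z‖ + Real.log ‖H z‖) (Metric.sphere 0 |1|) := by
    intro z hz
    rw [abs_one] at hz
    simp only [norm_mul, Real.log_mul (hQ z hz) (hH' z hz)]
  have hQint : CircleIntegrable (fun z => Real.log ‖(polePoly hfin).eval z‖) 0 1 :=
    ((polePoly hfin).continuous.norm.continuousOn.log hQ).circleIntegrable zero_le_one
  have hHcont : ContinuousOn H (Metric.sphere 0 1) :=
    (hH.continuousOn.mono (closure_ball (0 : ℂ) one_ne_zero).ge).mono hsub
  rw [Real.circleAverage_congr_sphere hsphere, Real.circleAverage_fun_add hQint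
    ((hHcont.norm.log hH').circleIntegrable zero_le_one), circleAverage_log_norm_eval_polePoly,
    circleAverage_log_norm_of_ne_zero (by rwa [abs_one]) (by rwa [abs_one]), zero_add]

section Energy

variable {r₀ : Circle → ℂ} {F : ℂ → ℂ} {S : ℂ → ℂ × ℂ}

theorem IsMeromorphicExtension.circleAverage_log_norm_fst (h : IsMeromorphicExtension r₀ F)
    (hF₀ : Tendsto F (𝓝[≠] 0) (𝓝 0)) (hr₀ : IsSobolevCircle fun x => r₀ (AddCircle.toCircle x))
    (hS : DiffContOnCl ℂ S (Metric.ball 0 1)) (hne : ∀ z ∈ Metric.closedBall 0 1, S z ≠ 0)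
    (hS0 : (S 0).1 = 1) (hSr : ∀ w : Circle, (S w).2 = (S w).1 * r₀ w) :
    Real.circleAverage (fun z => Real.log ‖(S z).1‖) 0 1 =
      -∑ᶠ a ∈ diskPoles F, (poleMultiplicity F a : ℝ) * Real.log ‖a‖ := by
  have hfin := h.finite_diskPoles
  obtain ⟨P, hcoprime, -, hP⟩ := h.exists_isCoprime_numerator hF₀ hr₀ hfin
  obtain ⟨H, hH, hSH⟩ := exists_eq_smul_of_isCoprime hS hcoprime fun w => by
    rw [hP, hSr, sobolevDiskAlgebra.aeval_coord_apply]
    ring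
  have hfst (z : ℂ) (hz : z ∈ Metric.closedBall 0 1) : (S z).1 = (polePoly hfin).eval z * H z := by
    rw [hSH z hz, Prod.smul_fst, smul_eq_mul, sobolevDiskAlgebra.aeval_coord_apply, mul_comm]
  have hHne (z : ℂ) (hz : z ∈ Metric.closedBall 0 1) : H z ≠ 0 := fun hzero =>
    hne z hz (by rw [hSH z hz, hzero, zero_smul])
  have hzero := zero_notMem_diskPoles h.meromorphic hF₀
  have hQH : Real.log ‖(polePoly hfin).eval 0‖ + Real.log ‖H 0‖ = 0 := by
    have h0 := Metric.mem_closedBall_self (x := (0 : ℂ)) zero_le_one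
    rw [← Real.log_mul (norm_ne_zero_iff.2 (eval_polePoly_ne_zero hfin hzero))
      (norm_ne_zero_iff.2 (hHne 0 h0)), ← norm_mul, ← hfst 0 h0, hS0, norm_one, Real.log_one]
  have hsphere : Set.EqOn (fun z => Real.log ‖(S z).1‖)
      (fun z => Real.log ‖(polePoly hfin).eval z * H z‖) (Metric.sphere 0 |1|) := fun z hz => by
    rw [abs_one] at hz
    simp only [hfst z (Metric.sphere_subset_closedBall hz)]
  rw [Real.circleAverage_congr_sphere hsphere,
    circleAverage_log_norm_eval_polePoly_mul hfin hH hHne, finsum_mem_eq_finite_toFinset_sum _ hfin]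
  have hlog := log_norm_eval_polePoly hfin hzero
  simp only [zero_sub, norm_neg] at hlog
  linarith

theorem log_spinorNormSq_of_snd_eq {s : ℂ × ℂ} (hs : s ≠ 0) {r : ℂ} (h : s.2 = s.1 * r) :
    Real.log (spinorNormSq s) = 2 * Real.log ‖s.1‖ + Real.log (1 + ‖r‖ ^ 2) := by
  have hfst : s.1 ≠ 0 := fun hzero => hs (Prod.ext hzero (by rw [h, hzero, zero_mul]; rfl))
  have hnorm : spinorNormSq s = ‖s.1‖ ^ 2 * (1 + ‖r‖ ^ 2) := by
    rw [spinorNormSq, h, map_mul, Complex.normSq_eq_norm_sq, Complex.normSq_eq_norm_sq]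
    ring
  rw [hnorm, Real.log_mul (pow_ne_zero 2 (norm_ne_zero_iff.2 hfst)) (by positivity),
    Real.log_pow, Nat.cast_two]

theorem eq_integral_add_circleAverage_of_log_spinorNormSq_eq
    (hS : ContinuousOn S (Metric.sphere 0 1)) (hne : ∀ w : Circle, S w ≠ 0)
    (hSr : ∀ w : Circle, (S w).2 = (S w).1 * r₀ w) {N : ℝ}
    (hN : ∀ w : Circle, Real.log (spinorNormSq (S w)) = N) :
    N = 1 / (2 * Real.pi) *
        (∫ θ in (0 : ℝ)..(2 * Real.pi), Real.log (1 + ‖r₀ (Circle.exp θ)‖ ^ 2)) +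
      2 * Real.circleAverage (fun z => Real.log ‖(S z).1‖) 0 1 := by
  have hfst (w : Circle) : (S w).1 ≠ 0 := fun hzero =>
    hne w (Prod.ext hzero (by rw [hSr, hzero, zero_mul]; rfl))
  have hexp (θ : ℝ) : (Circle.exp θ : ℂ) = circleMap 0 1 θ := by
    simp [circleMap, Circle.coe_exp]
  have hpoint (θ : ℝ) : Real.log (1 + ‖r₀ (Circle.exp θ)‖ ^ 2) =
      N - 2 * Real.log ‖(S (circleMap 0 1 θ)).1‖ := by
    rw [← hN (Circle.exp θ), log_spinorNormSq_of_snd_eq (hne _) (hSr _), hexp, add_sub_cancel_left]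
  have hint : CircleIntegrable (fun z => Real.log ‖(S z).1‖) 0 1 :=
    (hS.fst.norm.log fun z hz => norm_ne_zero_iff.2 (hfst ⟨z, hz⟩)).circleIntegrable zero_le_one
  simp only [hpoint]
  rw [Real.circleAverage_def, intervalIntegral.integral_sub intervalIntegrable_const
    (hint.const_mul 2), intervalIntegral.integral_const_mul, intervalIntegral.integral_const,
    smul_eq_mul, smul_eq_mul, sub_zero]
  field_simp [Real.two_pi_pos.ne']
  ring

end Energy

theorem IsRephasedPulse.hasSum_energy {ρ : ℤ} {M : Circle → Fin 3 → ℝ} {ω : ℤ → ℂ}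
    (hω : IsRephasedPulse ρ M ω) {r₀ : Circle → ℂ} {F : ℂ → ℂ} (h : IsMeromorphicExtension r₀ F)
    (hF₀ : Tendsto F (𝓝[≠] 0) (𝓝 0)) (hr₀ : IsSobolevCircle fun x => r₀ (AddCircle.toCircle x))
    (hM : ∀ w, M w = hopf (1, (w : ℂ) ^ (-ρ) * r₀ w)) :
    HasSum (fun j : ℤ => Real.log (1 + Real.tan (‖ω j‖ / 2) ^ 2))
      (1 / (2 * Real.pi) *
          (∫ θ in (0 : ℝ)..(2 * Real.pi), Real.log (1 + ‖r₀ (Circle.exp θ)‖ ^ 2))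
        - 2 * ∑ᶠ a ∈ diskPoles F, (poleMultiplicity F a : ℝ) * Real.log ‖a‖) := by
  have hγ := summable_norm_paramsBefore hω.summable ρ
  have hS := diffContOnCl_scatteringSpinor hγ
  have hne (z : ℂ) (hz : z ∈ Metric.closedBall 0 1) := scatteringSpinor_ne_zero hγ
    (mem_closedBall_zero_iff.1 hz)
  have hSr (w : Circle) := hω.scatteringSpinor_snd_eq (hM w)
  have hsum (w : Circle) := hω.hasSum_log_one_add_sq_tan w.norm_coe
  have hsphere : ContinuousOn (scatteringSpinor (paramsBefore ω ρ)) (Metric.sphere 0 1) :=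
    hS.continuousOn.mono fun z hz => coe_circle_mem_closure_ball ⟨z, hz⟩
  have henergy := eq_integral_add_circleAverage_of_log_spinorNormSq_eq hsphere
    (fun w => scatteringSpinor_ne_zero hγ w.norm_coe.le) hSr fun w => (hsum w).unique (hsum 1)
  rw [h.circleAverage_log_norm_fst hF₀ hr₀ hS hne (by rw [scatteringSpinor_zero]) hSr, mul_neg,
    ← sub_eq_add_neg] at henergy
  exact henergy ▸ hsum 1

theorem mainTheorem4 (M : Circle → Fin 3 → ℝ) (hM : ∀ w, M w ⬝ᵥ M w = 1)
    (hMz : ∀ w, M w 2 ≠ -1) (hr : MemSobolevH1 (reflectionCoeff M))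
    (ρ : ℤ) (r₀ : Circle → ℂ)
    (hr₀ : ∀ w : Circle, reflectionCoeff M w = (w : ℂ) ^ (-ρ) * r₀ w)
    (F : ℂ → ℂ) (hF : IsMeromorphicExtension r₀ F) (hF₀ : Tendsto F (𝓝[≠] 0) (𝓝 0)) :
    (diskPoles F).Finite ∧
    (∃ ω : ℤ → ℂ, IsRephasedPulse ρ M ω) ∧
    ∀ ω : ℤ → ℂ, IsRephasedPulse ρ M ω →
      HasSum (fun j : ℤ => Real.log (1 + Real.tan (‖ω j‖ / 2) ^ 2))
        (1 / (2 * Real.pi) *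
            (∫ θ in (0 : ℝ)..(2 * Real.pi),
              Real.log (1 + ‖reflectionCoeff M (Circle.exp θ)‖ ^ 2))
          - 2 * ∑ᶠ z ∈ diskPoles F, (poleMultiplicity F z : ℝ) * Real.log ‖z‖) := by
  have hzpow (w : Circle) : (w : ℂ) ^ ρ * (w : ℂ) ^ (-ρ) = 1 := by
    rw [← zpow_add₀ w.coe_ne_zero, add_neg_cancel, zpow_zero]
  have hcont : Continuous (reflectionCoeff M) := by
    rw [funext hr₀]
    exact (continuous_induced_dom.zpow₀ _ fun w => .inl w.coe_ne_zero).mul hF.continuous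
  have hsob : IsSobolevCircle fun x => r₀ (AddCircle.toCircle x) := by
    convert (isSobolevCircle_unitPoint_zpow ρ).mul (hr.isSobolevCircle hcont) using 2 with x
    rw [hr₀, ← mul_assoc, hzpow, one_mul]
  have hMh (w : Circle) : M w = hopf (1, (w : ℂ) ^ (-ρ) * r₀ w) := by
    rw [← hr₀]
    exact eq_hopf_one_reflectionCoeff (hM w) (hMz w)
  have hnorm (w : Circle) : ‖reflectionCoeff M w‖ = ‖r₀ w‖ := by
    rw [hr₀, norm_mul, norm_zpow, w.norm_coe, one_zpow, one_mul]
  refine ⟨hF.finite_diskPoles, hF.exists_isRephasedPulse hF₀ hsob hMh, fun ω hω => ?_⟩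
  simpa only [hnorm] using hω.hasSum_energy hF hF₀ hsob hMh
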